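/- Let $\mathsf T$ be the rooted binary tree, whose vertices are the finite words over $\{0,1\}$, and let $\partial\mathsf T=\{0,1\}^{\mathbb N}$ be its boundary. Let $\mathfrak G$ be the first Grigorchuk group, generated by the automorphisms $$a=\varepsilon,\qquad b=(a,c),\qquad c=(a,d),\qquad d=(1,b),$$ where $\varepsilon$ exchanges the two subtrees of the root and $(g_0,g_1)$ fixes the first letter and acts by $g_i$ on the subtree at the vertex $i$. An invariant random subgroup (IRS) of $\mathfrak G$ is a Borel probability measure on the space ${\rm Sub}(\mathfrak G)$ of subgroups, with the Chabauty topology, that is invariant under conjugation. *Notation.* ${\rm Fix}(H)\subseteq\partial\mathsf T$ is the set of common fixed points of $H\le\mathfrak G$; ${\rm Fix}_{\mathfrak G}(C)$ is the pointwise stabilizer of $C\subseteq\partial\mathsf T$; ${\rm St}_{\mathfrak G}(m)$ is the subgroup of the elements fixing every vertex of level $m$. For a vertex $v$, $C_v$ is the set of rays with prefix $v$, ${\rm Rist}(v)$ is the group of elements of $\mathfrak G$ fixing every point outside $C_v$, and ${\rm Rist}_m(\mathsf T_v)=\prod_{|w|=m}{\rm Rist}(vw)$. For a closed $K\subseteq\partial\mathsf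 T$, $I_K$ is the set of vertices $v$ such that $C_v\cap K=\emptyset$ and, unless $v$ is the root, $C_{v'}\cap K\ne\emptyset$ for the parent $v'$ of $v$. The profinite completion $\bar{\mathfrak G}$ acts on $\partial\mathsf T$ through its finite quotients $\mathfrak G/{\rm St}_{\mathfrak G}(n)$, and $\eta$ is its Haar probability measure. The space $F(\partial\mathsf T)$ of closed subsets of $\partial\mathsf T$ carries the Vietoris topology. **Statement.** Every ergodic IRS $\mu$ of $\mathfrak G$ is of one of the following (mutually exclusive) types. (i) ${\rm Fix}(H)=\emptyset$ for $\mu$-a.e. $H$. In this case $\mu$-a.e. $H$ has finite index in $\mathfrak G$, and there is a constant $m\in\mathbb N$ such that $\mu$-a.e. $H$ contains ${\rm St}_{\mathfrak G}(m)$. (ii) ${\rm Fix}(H)$ is non-empty and clopen for $\mu$-a.e. $H$. In this case $\mu$ is atomic, and there are a non-empty clopen subset $C\subseteq\partial\mathsf T$ and a finite index subgroup $\Gamma$ of ${\rm Fix}_{\mathfrak G}(C)$ such that $\Gamma$ has finitely many $\mathfrak G$-conjugates and $\mu$ is the uniform measure on them. (iii) ${\rm Fix}(H)$ is not clopen for $\mu$-a.e.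 $H$. In this case $\mu$ has no atoms, and there are a closed but not clopen subset $C\subseteq\partial\mathsf T$ and a sequence $(m_i)_{i\ge 0}$ of non-negative integers such that ${\rm Fix}(H)$ is a Haar-random translate of $C$, that is, $$\mu(\{H:{\rm Fix}(H)\in B\})=\eta(\{g\in\bar{\mathfrak G}: g\cdot C\in B\})\quad\text{for every Borel } B\subseteq F(\partial\mathsf T),$$ and $\mu$-a.e. $H$ contains $$\bigoplus_{v\in I_{{\rm Fix}(H)}}\left[{\rm Rist}_{m_{|v|}}(\mathsf T_v),{\rm Rist}_{m_{|v|}}(\mathsf T_v)\right].$$ -/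

import Mathlib

open MeasureTheory ProbabilityTheory TopologicalSpace
open scoped Pointwise

namespace FirstGrigorchuk

/-! ### The boundary of the rooted binary tree

A vertex of the rooted binary tree is a word, that is, a `List Bool` (`false` and `true` stand for
the letters `0` and `1`); the root is `[]`. The boundary consists of the infinite words. -/

/-- Infinite rays of the rooted binary tree, with the product topology. -/
abbrev Ray : Type := ℕ → Bool

/-- The ray without its first letter. -/
def tail (x : Ray) : Ray := fun n => x (n + 1)

/-- The rays that start with the word `v`. -/
def cylinder (v : List Bool) : Set Ray := {x | ∀ (i : ℕ) (h : i < v.length), x i = v[i]}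

/-- The first `n` letters of a ray, as a vertex of level `n`. -/
def pre (n : ℕ) (x : Ray) : Fin n → Bool := fun i => x i

/-- A ray through a given vertex of level `n`. -/
def ext (n : ℕ) (v : Fin n → Bool) : Ray := fun i => if h : i < n then v ⟨i, h⟩ else false

/-! ### The generators -/

/-- The root permutation `a = ε`. -/
def aFun (x : Ray) : Ray
  | 0 => !(x 0)
  | n + 1 => x (n + 1)

mutual
/-- `bAt n x` is the `n`-th letter of the image of `x` under `b = (a, c)`. -/
def bAt : ℕ → Ray → Bool
  | 0, x => x 0
  | n + 1, x => if x 0 then cAt n (tail x) else aFun (tail x) n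
/-- `cAt n x` is the `n`-th letter of the image of `x` under `c = (a, d)`. -/
def cAt : ℕ → Ray → Bool
  | 0, x => x 0
  | n + 1, x => if x 0 then dAt n (tail x) else aFun (tail x) n
/-- `dAt n x` is the `n`-th letter of the image of `x` under `d = (1, b)`. -/
def dAt : ℕ → Ray → Bool
  | 0, x => x 0
  | n + 1, x => if x 0 then bAt n (tail x) else tail x n
end

def bFun (x : Ray) : Ray := fun n => bAt n x
def cFun (x : Ray) : Ray := fun n => cAt n x
def dFun (x : Ray) : Ray := fun n => dAt n x

/-- The map `(g₀, g₁)` that keeps the first letter and acts by `g₀` on the rest of the rays starting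
with `0`, and by `g₁` on the rest of the rays starting with `1`. -/
def wreath (g₀ g₁ : Ray → Ray) (x : Ray) : Ray
  | 0 => x 0
  | n + 1 => if x 0 then g₁ (tail x) n else g₀ (tail x) n

theorem bFun_eq : bFun = wreath aFun cFun := by
  funext x n; cases n <;> simp [bFun, wreath, bAt, cFun]

theorem cFun_eq : cFun = wreath aFun dFun := by
  funext x n; cases n <;> simp [cFun, wreath, cAt, dFun]

theorem dFun_eq : dFun = wreath id bFun := by
  funext x n; cases n <;> simp [dFun, wreath, dAt, bFun]

theorem aFun_invol : Function.Involutive aFun := by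
  intro x; funext n; cases n <;> simp [aFun]

theorem tail_wreath (g₀ g₁ : Ray → Ray) (x : Ray) :
    tail (wreath g₀ g₁ x) = if x 0 then g₁ (tail x) else g₀ (tail x) := by
  funext n; cases h : x 0 <;> simp [tail, wreath, h]

theorem bcd_invol (n : ℕ) : (∀ x, bFun (bFun x) n = x n) ∧ (∀ x, cFun (cFun x) n = x n) ∧
    (∀ x, dFun (dFun x) n = x n) := by
  induction n with
  | zero => simp [bFun, cFun, dFun, bAt, cAt, dAt]
  | succ n ih =>
    obtain ⟨hb, hc, hd⟩ := ih
    refine ⟨fun x => ?_, fun x => ?_, fun x => ?_⟩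
    · have key : bFun (bFun x) (n + 1) = wreath aFun cFun (wreath aFun cFun x) (n + 1) := by
        rw [bFun_eq]
      rw [key]
      show (if wreath aFun cFun x 0 then _ else _) = _
      rw [tail_wreath]
      cases h : x 0 <;> simp [wreath, h, hc, aFun_invol _, tail]
    · have key : cFun (cFun x) (n + 1) = wreath aFun dFun (wreath aFun dFun x) (n + 1) := by
        rw [cFun_eq]
      rw [key]
      show (if wreath aFun dFun x 0 then _ else _) = _
      rw [tail_wreath]
      cases h : x 0 <;> simp [wreath, h, hd, aFun_invol _, tail]
    · have key : dFun (dFun x) (n + 1) = wreath id bFun (wreath id bFun x) (n + 1) := by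
        rw [dFun_eq]
      rw [key]
      show (if wreath id bFun x 0 then _ else _) = _
      rw [tail_wreath]
      cases h : x 0 <;> simp [wreath, h, hb, tail]

theorem bFun_invol : Function.Involutive bFun := fun x => funext fun n => (bcd_invol n).1 x
theorem cFun_invol : Function.Involutive cFun := fun x => funext fun n => (bcd_invol n).2.1 x
theorem dFun_invol : Function.Involutive dFun := fun x => funext fun n => (bcd_invol n).2.2 x

def genA : Equiv.Perm Ray := aFun_invol.toPerm aFun
def genB : Equiv.Perm Ray := bFun_invol.toPerm bFun
def genC : Equiv.Perm Ray := cFun_invol.toPerm cFun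
def genD : Equiv.Perm Ray := dFun_invol.toPerm dFun

/-- The first Grigorchuk group, as a group of permutations of the boundary of the binary tree. -/
def grigorchuk : Subgroup (Equiv.Perm Ray) := Subgroup.closure {genA, genB, genC, genD}

/-! ### Elements of the group are induced by tree automorphisms -/

theorem pre_eq_iff {n : ℕ} {x y : Ray} : pre n x = pre n y ↔ ∀ i < n, x i = y i :=
  ⟨fun h i hi => congrFun h ⟨i, hi⟩, fun h => funext fun i => h i i.2⟩

theorem pre_ext (n : ℕ) (v : Fin n → Bool) : pre n (ext n v) = v := by
  funext i; simp [pre, ext]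

theorem aFun_pre {n : ℕ} {x y : Ray} (h : ∀ i < n, x i = y i) :
    ∀ i < n, aFun x i = aFun y i := by
  intro i hi
  cases i with
  | zero => simp [aFun, h 0 hi]
  | succ i => simp [aFun, h _ hi]

theorem bcd_pre (n : ℕ) : ∀ x y : Ray, (∀ i ≤ n, x i = y i) →
    bFun x n = bFun y n ∧ cFun x n = cFun y n ∧ dFun x n = dFun y n := by
  induction n with
  | zero => intro x y h; simp [bFun, cFun, dFun, bAt, cAt, dAt, h 0 le_rfl]
  | succ n ih =>
    intro x y h
    have ht : ∀ i ≤ n, tail x i = tail y i := fun i hi => h (i + 1) (by omega)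
    obtain ⟨hb, hc, hd⟩ := ih _ _ ht
    have ha : aFun (tail x) n = aFun (tail y) n :=
      aFun_pre (n := n + 1) (fun i hi => ht i (by omega)) n (by omega)
    have h0 := h 0 (by omega)
    refine ⟨?_, ?_, ?_⟩
    · rw [bFun_eq]; simp only [wreath, h0, ha, hc]
    · rw [cFun_eq]; simp only [wreath, h0, ha, hd]
    · rw [dFun_eq]; simp only [wreath, h0, hb, id, ht n le_rfl]

theorem pre_smul_aux {g : Equiv.Perm Ray} (hg : g ∈ grigorchuk) :
    ∀ (n : ℕ) (x y : Ray), pre n (g x) = pre n (g y) ↔ pre n x = pre n y := by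
  have inv : ∀ (f : Ray → Ray) (hf : Function.Involutive f),
      (∀ n x y, pre n x = pre n y → pre n (f x) = pre n (f y)) →
      ∀ n x y, pre n (hf.toPerm f x) = pre n (hf.toPerm f y) ↔ pre n x = pre n y := by
    intro f hf h n x y
    refine ⟨fun h' => ?_, h n x y⟩
    have := h n _ _ h'
    simpa [hf x, hf y] using this
  induction hg using Subgroup.closure_induction with
  | mem g hg =>
    rcases hg with rfl | rfl | rfl | rfl
    · exact inv _ aFun_invol fun n x y h =>
        pre_eq_iff.2 (aFun_pre (pre_eq_iff.1 h))
    · exact inv _ bFun_invol fun n x y h => pre_eq_iff.2 fun i hi =>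
        (bcd_pre i x y fun j hj => pre_eq_iff.1 h j (by omega)).1
    · exact inv _ cFun_invol fun n x y h => pre_eq_iff.2 fun i hi =>
        (bcd_pre i x y fun j hj => pre_eq_iff.1 h j (by omega)).2.1
    · exact inv _ dFun_invol fun n x y h => pre_eq_iff.2 fun i hi =>
        (bcd_pre i x y fun j hj => pre_eq_iff.1 h j (by omega)).2.2
  | one => intro n x y; rfl
  | mul g h _ _ ihg ihh => intro n x y; rw [Equiv.Perm.mul_apply, Equiv.Perm.mul_apply, ihg, ihh]
  | inv g _ ih =>
    intro n x y
    rw [← ih n (g⁻¹ x) (g⁻¹ y)]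
    simp

theorem pre_smul (g : grigorchuk) {n : ℕ} {x y : Ray} (h : pre n x = pre n y) :
    pre n (g • x) = pre n (g • y) := (pre_smul_aux g.2 n x y).2 h

/-- The action on the vertices of level `n`. -/
def levelHom (n : ℕ) : grigorchuk →* Equiv.Perm (Fin n → Bool) :=
  MonoidHom.toHomPerm
    { toFun := fun g v => pre n (g • ext n v)
      map_one' := by
        funext v
        show pre n ((1 : grigorchuk) • ext n v) = v
        rw [one_smul, pre_ext]
      map_mul' := by
        intro g h
        funext v
        show pre n ((g * h) • ext n v) = pre n (g • ext n (pre n (h • ext n v)))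
        rw [mul_smul]
        exact pre_smul g (pre_ext n _).symm }

theorem levelHom_pre (n : ℕ) (g : grigorchuk) (x : Ray) :
    levelHom n g (pre n x) = pre n (g • x) := by
  show pre n (g • ext n (pre n x)) = _
  exact pre_smul g (pre_ext n _)

/-- The level stabilizer `St(n)`: the elements that fix every vertex of level `n`. -/
def levelStab (n : ℕ) : Subgroup grigorchuk := (levelHom n).ker

instance (n : ℕ) : (levelStab n).Normal := inferInstanceAs (levelHom n).ker.Normal

instance (n : ℕ) : (levelStab n).FiniteIndex := inferInstanceAs (levelHom n).ker.FiniteIndex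

/-! ### Fixed point sets and rigid stabilizers -/

/-- A map of rays in which each letter of the image depends on finitely many letters of the ray is
continuous. -/
theorem continuous_of_pre {f : Ray → Ray} (F : ∀ n : ℕ, (Fin (n + 1) → Bool) → Bool)
    (h : ∀ x n, f x n = F n (pre (n + 1) x)) : Continuous f := by
  refine continuous_pi fun n => ?_
  have : (fun x => f x n) = F n ∘ pre (n + 1) := funext fun x => h x n
  rw [this]
  exact continuous_of_discreteTopology.comp (continuous_pi fun i => continuous_apply _)

theorem continuous_smul (g : grigorchuk) : Continuous fun x : Ray => g • x :=
  continuous_of_pre (fun n v => levelHom (n + 1) g v (Fin.last n)) fun x n => by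
    rw [levelHom_pre]; rfl

theorem isClosed_fixedPoints (H : Subgroup grigorchuk) :
    IsClosed (MulAction.fixedPoints H Ray) := by
  have : MulAction.fixedPoints H Ray = ⋂ h : H, {x : Ray | (h : grigorchuk) • x = x} := by
    ext x; simp [MulAction.mem_fixedPoints, Subgroup.smul_def]
  rw [this]
  exact isClosed_iInter fun h => isClosed_eq (continuous_smul _) continuous_id

/-- `Fix(H)`, as a point of the space of closed subsets of the boundary. As the boundary is compact,
this space is `Compacts Ray`, and Mathlib gives it the Vietoris topology. -/
def fix (H : Subgroup grigorchuk) : Compacts Ray :=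
  ⟨MulAction.fixedPoints H Ray, (isClosed_fixedPoints H).isCompact⟩

/-- The rigid stabilizer of `U`: the elements that fix every point outside `U`. -/
def rigidStab (U : Set Ray) : Subgroup grigorchuk := fixingSubgroup grigorchuk Uᶜ

/-- The rigid stabilizer `Rist_m(T_v)` of level `m` of the subtree rooted at `v`: the product of the
rigid stabilizers of the descendants of `v` that lie `m` levels below `v`. -/
def rist (m : ℕ) (v : List Bool) : Subgroup grigorchuk :=
  ⨆ (w : List Bool) (_ : w.length = m), rigidStab (cylinder (v ++ w))

/-- The index set `I_K`: the vertices whose cylinders are the maximal ones disjoint from `K`. -/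
def index (K : Set Ray) : Set (List Bool) :=
  {v | cylinder v ∩ K = ∅ ∧ (v ≠ [] → (cylinder v.dropLast ∩ K).Nonempty)}

/-- The direct sum over `v ∈ I_K` of the derived subgroups of `Rist_{m_{|v|}}(T_v)`, as a subgroup of
the Grigorchuk group: the summands commute as their supports are disjoint. -/
def derivedSum (m : ℕ → ℕ) (K : Set Ray) : Subgroup grigorchuk :=
  ⨆ v ∈ index K, ⁅rist (m v.length) v, rist (m v.length) v⁆

/-! ### The space of subgroups -/

open Classical in
/-- The Chabauty topology: the restriction of the product topology of `{0, 1}^G`. -/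
noncomputable instance : TopologicalSpace (Subgroup grigorchuk) :=
  .induced (fun H (g : grigorchuk) => decide (g ∈ H)) inferInstance

noncomputable instance : MeasurableSpace (Subgroup grigorchuk) := borel _

instance : BorelSpace (Subgroup grigorchuk) := ⟨rfl⟩

/-! ### The profinite completion and its action on the boundary -/

/-- The profinite completion of the Grigorchuk group. -/
abbrev Completion : Type := ProfiniteGrp.ProfiniteCompletion.completion (GrpCat.of grigorchuk)

instance : MeasurableSpace Completion := borel _

instance : BorelSpace Completion := ⟨rfl⟩

/-- The Haar probability measure of the profinite completion. -/
noncomputable def haar : Measure Completion := Measure.haarMeasure ⊤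

/-- The action of the profinite completion on the vertices of level `n`, through its projection to
the finite quotient by the level stabilizer. -/
noncomputable def completionLevel (n : ℕ) (γ : Completion) : Equiv.Perm (Fin n → Bool) :=
  QuotientGroup.kerLift (levelHom n) (γ.1 (FiniteIndexNormalSubgroup.ofSubgroup (levelStab n)))

/-- The action of the profinite completion on the boundary. -/
noncomputable def act (γ : Completion) (x : Ray) : Ray :=
  fun n => completionLevel (n + 1) γ (pre (n + 1) x) (Fin.last n)

/-- The action of the completion extends that of the group. -/
theorem act_eta (g : grigorchuk) (x : Ray) :
    act (ProfiniteGrp.ProfiniteCompletion.etaFn (GrpCat.of grigorchuk) g) x = g • x := by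
  funext n
  show levelHom (n + 1) g (pre (n + 1) x) (Fin.last n) = _
  rw [levelHom_pre]; rfl

theorem continuous_act (γ : Completion) : Continuous (act γ) :=
  continuous_of_pre (fun n v => completionLevel (n + 1) γ v (Fin.last n)) fun _ _ => rfl

/-- The translate of a closed set by an element of the profinite completion. -/
noncomputable def bdryTranslate (γ : Completion) (K : Compacts Ray) : Compacts Ray :=
  K.map (act γ) (continuous_act γ)

end FirstGrigorchuk

open FirstGrigorchuk

namespace FirstGrigorchuk

open scoped commutatorElement

/-! ### The wreath recursion -/

-- The engine is a double commutator argument for a random subgroup H. Let U be a cylinder and g an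
-- element with U and gU disjoint. Conjugating H by the elements of Rist(U), invariance of μ and a
-- counting argument show that almost surely, if g ∈ H, the elements p of Rist(U) that can be
-- completed to pp' ∈ H with p' supported on gU form a subgroup of finite index
-- (`ae_relIndex_partner_ne_zero`). If H moves a ray x to gx, this yields a second h ∈ H with x, gx,
-- hx distinct. For U small around x, complete p by p' on gU and q by q' on hU: the commutator of
-- pp' and qq' is [p, q], which thus lies in H (`exists_commutatorBelow_of_smul_ne`). Compactness
-- extends this to every vertex whose cylinder misses Fix(H), and ergodicity makes the required
-- depth depend only on the level of the vertex (`exists_level_ae`).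
--
-- The input from group theory is that the group is regular branch over K, the normal closure of
-- (ab)², with St(4) ≤ K and St(8) ≤ K'. This gives the congruence subgroup property
-- (`exists_levelStab_le`), which lets one pass from finite index in Rist(v) to containing some
-- Rist_m(T_v) (`exists_rist_le`). For clopen C, the inclusion St(8) ≤ K' also shows that the sum of
-- derived rigid stabilizers contains St(M) ∩ Fix_G(C) for some M
-- (`exists_levelStab_inf_le_derivedSum`).
--
-- Suppose that Fix(H) equals some clopen C with positive probability. Almost surely on that event H
-- lies between St(M) ∩ Fix_G(C) and Fix_G(C), which leaves finitely many candidates. If C is empty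
-- the event is conjugation invariant, hence almost sure, and H contains St(M). If C is non-empty,
-- one candidate is an atom, and an ergodic invariant probability measure with an atom is uniform on
-- a finite conjugacy class.
--
-- Otherwise Fix(H) is almost surely not clopen, because there are only countably many clopen sets.
-- An atom would give a closed set with finitely many translates, which minimality forces to be
-- clopen (`isClopen_of_finite_translates`). Finally, let C be a typical value of Fix(H). On each
-- level, the trace of Fix(H) and the trace of a Haar-random translate of C are both uniform on the
-- same finite orbit, and traces determine laws on the space of closed sets (`fix_law_eq_haar`).

theorem ray_ext {x y : Ray} (h0 : x 0 = y 0) (ht : tail x = tail y) : x = y := by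
  funext n
  cases n with
  | zero => exact h0
  | succ n => exact congrFun ht n

theorem wreath_comp (g₀ g₁ h₀ h₁ : Ray → Ray) (x : Ray) :
    wreath g₀ g₁ (wreath h₀ h₁ x) = wreath (g₀ ∘ h₀) (g₁ ∘ h₁) x := by
  refine ray_ext rfl ?_
  rw [tail_wreath, tail_wreath, tail_wreath]
  cases h : x 0 <;> simp [wreath, h]

theorem wreath_id (x : Ray) : wreath id id x = x := by
  refine ray_ext rfl ?_
  rw [tail_wreath]
  simp

/-- The permutation `(g₀, g₁)` of the rays. -/
def node (g₀ g₁ : Equiv.Perm Ray) : Equiv.Perm Ray where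
  toFun := wreath g₀ g₁
  invFun := wreath g₀.symm g₁.symm
  left_inv x := by
    rw [wreath_comp, Equiv.symm_comp_self, Equiv.symm_comp_self, wreath_id]
  right_inv x := by
    rw [wreath_comp, Equiv.self_comp_symm, Equiv.self_comp_symm, wreath_id]

theorem node_apply_zero (g₀ g₁ : Equiv.Perm Ray) (x : Ray) : node g₀ g₁ x 0 = x 0 := rfl

theorem tail_node (g₀ g₁ : Equiv.Perm Ray) (x : Ray) :
    tail (node g₀ g₁ x) = if x 0 then g₁ (tail x) else g₀ (tail x) := tail_wreath _ _ _

theorem node_mul (g₀ g₁ h₀ h₁ : Equiv.Perm Ray) :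
    node g₀ g₁ * node h₀ h₁ = node (g₀ * h₀) (g₁ * h₁) :=
  Equiv.ext fun x => wreath_comp _ _ _ _ x

theorem node_one : node 1 1 = 1 := Equiv.ext fun x => wreath_id x

theorem node_inv (g₀ g₁ : Equiv.Perm Ray) : (node g₀ g₁)⁻¹ = node g₀⁻¹ g₁⁻¹ := rfl

/-- The ray with first letter `i` and tail `x`. -/
def cons (i : Bool) (x : Ray) : Ray
  | 0 => i
  | n + 1 => x n

@[simp] theorem cons_zero (i : Bool) (x : Ray) : cons i x 0 = i := rfl
@[simp] theorem tail_cons (i : Bool) (x : Ray) : tail (cons i x) = x := rfl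

theorem node_inj {g₀ g₁ h₀ h₁ : Equiv.Perm Ray} (h : node g₀ g₁ = node h₀ h₁) :
    g₀ = h₀ ∧ g₁ = h₁ := by
  constructor <;> ext1 x
  · have := congrArg tail (DFunLike.congr_fun h (cons false x))
    simpa [tail_node] using this
  · have := congrArg tail (DFunLike.congr_fun h (cons true x))
    simpa [tail_node] using this

theorem genA_mul_self : genA * genA = 1 := Equiv.ext fun x => aFun_invol x
theorem genB_mul_self : genB * genB = 1 := Equiv.ext fun x => bFun_invol x
theorem genC_mul_self : genC * genC = 1 := Equiv.ext fun x => cFun_invol x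
theorem genD_mul_self : genD * genD = 1 := Equiv.ext fun x => dFun_invol x

theorem genA_inv : genA⁻¹ = genA := inv_eq_of_mul_eq_one_left genA_mul_self
theorem genB_inv : genB⁻¹ = genB := inv_eq_of_mul_eq_one_left genB_mul_self
theorem genC_inv : genC⁻¹ = genC := inv_eq_of_mul_eq_one_left genC_mul_self
theorem genD_inv : genD⁻¹ = genD := inv_eq_of_mul_eq_one_left genD_mul_self

theorem genB_eq : genB = node genA genC := Equiv.ext fun x => congrFun bFun_eq x
theorem genC_eq : genC = node genA genD := Equiv.ext fun x => congrFun cFun_eq x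
theorem genD_eq : genD = node 1 genB := Equiv.ext fun x => congrFun dFun_eq x

theorem tail_genA (x : Ray) : tail (genA x) = tail x := rfl
theorem genA_apply_zero (x : Ray) : genA x 0 = !(x 0) := rfl

theorem genA_conj_node (g₀ g₁ : Equiv.Perm Ray) : genA * node g₀ g₁ * genA = node g₁ g₀ := by
  ext1 x
  refine ray_ext ?_ ?_
  · simp [Equiv.Perm.mul_apply, genA_apply_zero, node_apply_zero]
  · simp only [Equiv.Perm.mul_apply, tail_genA, tail_node, genA_apply_zero]
    split_ifs <;> simp_all

theorem genA_mul_node (g₀ g₁ : Equiv.Perm Ray) : genA * node g₀ g₁ = node g₁ g₀ * genA := by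
  rw [← genA_conj_node g₀ g₁, mul_assoc _ genA genA, genA_mul_self, mul_one]

theorem bcd_comp (n : ℕ) : ∀ x, bFun (cFun x) n = dFun x n ∧ cFun (dFun x) n = bFun x n ∧
    dFun (bFun x) n = cFun x n := by
  induction n with
  | zero => intro x; simp [bFun, cFun, dFun, bAt, cAt, dAt]
  | succ n ih =>
    intro x
    have hb : ∀ y n, bFun y (n + 1) = if y 0 then cFun (tail y) n else aFun (tail y) n := by
      intro y n; rw [bFun_eq]; rfl
    have hc : ∀ y n, cFun y (n + 1) = if y 0 then dFun (tail y) n else aFun (tail y) n := by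
      intro y n; rw [cFun_eq]; rfl
    have hd : ∀ y n, dFun y (n + 1) = if y 0 then bFun (tail y) n else tail y n := by
      intro y n; rw [dFun_eq]; rfl
    have tb : tail (bFun x) = if x 0 then cFun (tail x) else aFun (tail x) := by
      rw [bFun_eq, tail_wreath]
    have tc : tail (cFun x) = if x 0 then dFun (tail x) else aFun (tail x) := by
      rw [cFun_eq, tail_wreath]
    have td : tail (dFun x) = if x 0 then bFun (tail x) else tail x := by
      rw [dFun_eq, tail_wreath]; rw [bFun_eq]; rfl
    have b0 : bFun x 0 = x 0 := rfl
    have c0 : cFun x 0 = x 0 := rfl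
    have d0 : dFun x 0 = x 0 := rfl
    obtain ⟨i1, i2, i3⟩ := ih (tail x)
    refine ⟨?_, ?_, ?_⟩
    · rw [hb, hd, tc, c0]; split_ifs <;> simp [i2, aFun_invol _]
    · rw [hc, hb, td, d0]; split_ifs <;> simp [i3]
    · rw [hd, hc, tb, b0]; split_ifs <;> simp [i1]

theorem genB_mul_genC : genB * genC = genD :=
  Equiv.ext fun x => funext fun n => (bcd_comp n x).1
theorem genC_mul_genD : genC * genD = genB :=
  Equiv.ext fun x => funext fun n => (bcd_comp n x).2.1
theorem genD_mul_genB : genD * genB = genC :=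
  Equiv.ext fun x => funext fun n => (bcd_comp n x).2.2

theorem genC_mul_genB : genC * genB = genD := by
  rw [← genC_mul_genD, ← mul_assoc, genC_mul_self, one_mul]
theorem genB_mul_genD : genB * genD = genC := by
  rw [← genB_mul_genC, ← mul_assoc, genB_mul_self, one_mul]
theorem genD_mul_genC : genD * genC = genB := by
  rw [← genD_mul_genB, ← mul_assoc, genD_mul_self, one_mul]

theorem mul_reassoc {g h k : Equiv.Perm Ray} (e : g * h = k) (z : Equiv.Perm Ray) :
    g * (h * z) = k * z := by rw [← mul_assoc, e]

theorem commutator_ac_b : ⁅genA * genC, genB⁆ = genA * genB * genA * genB := by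
  simp only [commutatorElement_def, mul_inv_rev, genA_inv, genB_inv, genC_inv, mul_assoc,
    mul_reassoc genC_mul_genB, mul_reassoc genD_mul_genC]

theorem genA_mem : genA ∈ grigorchuk := Subgroup.subset_closure (by simp)
theorem genB_mem : genB ∈ grigorchuk := Subgroup.subset_closure (by simp)
theorem genC_mem : genC ∈ grigorchuk := Subgroup.subset_closure (by simp)
theorem genD_mem : genD ∈ grigorchuk := Subgroup.subset_closure (by simp)

/-- A subgroup containing the generators contains the group. -/
theorem grigorchuk_le {S : Subgroup (Equiv.Perm Ray)} (ha : genA ∈ S) (hb : genB ∈ S)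
    (hc : genC ∈ S) (hd : genD ∈ S) : grigorchuk ≤ S := by
  refine (Subgroup.closure_le S).2 ?_
  rintro g (rfl | rfl | rfl | rfl) <;> assumption

/-- Elements of the group are `(g₀, g₁)` or `(g₀, g₁)a` with sections in the group. -/
theorem exists_sections {g : Equiv.Perm Ray} (hg : g ∈ grigorchuk) :
    ∃ g₀ ∈ grigorchuk, ∃ g₁ ∈ grigorchuk, g = node g₀ g₁ ∨ g = node g₀ g₁ * genA := by
  induction hg using Subgroup.closure_induction with
  | mem g hg =>
    rcases hg with rfl | rfl | rfl | rfl
    · exact ⟨1, one_mem _, 1, one_mem _, .inr (by rw [node_one, one_mul])⟩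
    · exact ⟨_, genA_mem, _, genC_mem, .inl genB_eq⟩
    · exact ⟨_, genA_mem, _, genD_mem, .inl genC_eq⟩
    · exact ⟨_, one_mem _, _, genB_mem, .inl genD_eq⟩
  | one => exact ⟨1, one_mem _, 1, one_mem _, .inl node_one.symm⟩
  | mul g h _ _ ihg ihh =>
    obtain ⟨g₀, hg₀, g₁, hg₁, rfl | rfl⟩ := ihg <;> obtain ⟨h₀, hh₀, h₁, hh₁, rfl | rfl⟩ := ihh
    · exact ⟨_, mul_mem hg₀ hh₀, _, mul_mem hg₁ hh₁, .inl (node_mul _ _ _ _)⟩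
    · exact ⟨_, mul_mem hg₀ hh₀, _, mul_mem hg₁ hh₁, .inr (by rw [← node_mul, mul_assoc])⟩
    · exact ⟨_, mul_mem hg₀ hh₁, _, mul_mem hg₁ hh₀, .inr (by
        rw [← node_mul, mul_assoc, genA_mul_node, mul_assoc])⟩
    · exact ⟨_, mul_mem hg₀ hh₁, _, mul_mem hg₁ hh₀, .inl (by
        rw [← node_mul, mul_assoc, ← mul_assoc genA, genA_conj_node])⟩
  | inv g _ ih =>
    obtain ⟨g₀, hg₀, g₁, hg₁, rfl | rfl⟩ := ih
    · exact ⟨_, inv_mem hg₀, _, inv_mem hg₁, .inl (node_inv _ _)⟩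
    · exact ⟨_, inv_mem hg₁, _, inv_mem hg₀, .inr (by
        rw [mul_inv_rev, genA_inv, node_inv, genA_mul_node])⟩

theorem sections_of_node_mem {g₀ g₁ : Equiv.Perm Ray} (h : node g₀ g₁ ∈ grigorchuk) :
    g₀ ∈ grigorchuk ∧ g₁ ∈ grigorchuk := by
  obtain ⟨h₀, hh₀, h₁, hh₁, e | e⟩ := exists_sections h
  · obtain ⟨rfl, rfl⟩ := node_inj e
    exact ⟨hh₀, hh₁⟩
  · have := congrFun (DFunLike.congr_fun e fun _ => false) 0
    simp [node_apply_zero, genA_apply_zero] at this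

theorem exists_node_of_apply_zero {g : Equiv.Perm Ray} (hg : g ∈ grigorchuk) {x : Ray}
    (hx : g x 0 = x 0) : ∃ g₀ ∈ grigorchuk, ∃ g₁ ∈ grigorchuk, g = node g₀ g₁ := by
  obtain ⟨g₀, hg₀, g₁, hg₁, h | h⟩ := exists_sections hg
  · exact ⟨g₀, hg₀, g₁, hg₁, h⟩
  · rw [h, Equiv.Perm.mul_apply, node_apply_zero, genA_apply_zero] at hx
    simp at hx

theorem node_swap_mem {g₀ g₁ : Equiv.Perm Ray} (h : node g₀ g₁ ∈ grigorchuk) :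
    node g₁ g₀ ∈ grigorchuk := by
  rw [← genA_conj_node]
  exact mul_mem (mul_mem genA_mem h) genA_mem

/-- Every element of the group is a left section of an element of the group. -/
theorem exists_node_left {g : Equiv.Perm Ray} (hg : g ∈ grigorchuk) :
    ∃ h ∈ grigorchuk, node g h ∈ grigorchuk := by
  induction hg using Subgroup.closure_induction with
  | mem g hg =>
    rcases hg with rfl | rfl | rfl | rfl
    · exact ⟨_, genC_mem, genB_eq ▸ genB_mem⟩
    · exact ⟨_, one_mem _, node_swap_mem (genD_eq ▸ genD_mem)⟩
    · exact ⟨_, genA_mem, node_swap_mem (genB_eq ▸ genB_mem)⟩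
    · exact ⟨_, genA_mem, node_swap_mem (genC_eq ▸ genC_mem)⟩
  | one => exact ⟨1, one_mem _, by rw [node_one]; exact one_mem _⟩
  | mul g h _ _ ihg ihh =>
    obtain ⟨g', hg', hg⟩ := ihg
    obtain ⟨h', hh', hh⟩ := ihh
    exact ⟨_, mul_mem hg' hh', node_mul _ _ _ _ ▸ mul_mem hg hh⟩
  | inv g _ ih =>
    obtain ⟨g', hg', hg⟩ := ih
    exact ⟨_, inv_mem hg', node_inv _ _ ▸ inv_mem hg⟩

/-! ### Subgroups normalized by the group -/

/-- `N` is a subgroup of the Grigorchuk group that the group normalizes. -/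
structure GNormal (N : Subgroup (Equiv.Perm Ray)) : Prop where
  le : N ≤ grigorchuk
  conj : ∀ g ∈ grigorchuk, ∀ n ∈ N, g * n * g⁻¹ ∈ N

theorem GNormal.node_swap {N : Subgroup (Equiv.Perm Ray)} (hN : GNormal N)
    {g₀ g₁ : Equiv.Perm Ray} (h : node g₀ g₁ ∈ N) : node g₁ g₀ ∈ N := by
  have := hN.conj _ genA_mem _ h
  rwa [genA_inv, genA_conj_node] at this

theorem GNormal.commutator_mem {N : Subgroup (Equiv.Perm Ray)} (hN : GNormal N)
    {n g : Equiv.Perm Ray} (hn : n ∈ N) (hg : g ∈ grigorchuk) : ⁅n, g⁆ ∈ N := by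
  rw [commutatorElement_def, mul_assoc, mul_assoc, ← mul_assoc g]
  exact mul_mem hn (hN.conj g hg _ (inv_mem hn))

theorem GNormal.commutator_mem' {N : Subgroup (Equiv.Perm Ray)} (hN : GNormal N)
    {n g : Equiv.Perm Ray} (hn : n ∈ N) (hg : g ∈ grigorchuk) : ⁅g, n⁆ ∈ N :=
  mul_mem (hN.conj g hg _ hn) (inv_mem hn)

/-- The subgroup `K`, the normal closure of `(ab)²`. -/
def branchK : Subgroup (Equiv.Perm Ray) :=
  Subgroup.closure {k | ∃ g ∈ grigorchuk, k = g * (genA * genB * genA * genB) * g⁻¹}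

/-- The element `(ab)²`. -/
abbrev elemX : Equiv.Perm Ray := genA * genB * genA * genB

theorem elemX_eq : elemX = node (genC * genA) (genA * genC) := by
  rw [elemX, mul_assoc, mul_assoc, ← mul_assoc genB, ← mul_assoc genA, ← mul_assoc genA,
    genB_eq, genA_conj_node, node_mul]

theorem elemX_mem_grigorchuk : elemX ∈ grigorchuk :=
  mul_mem (mul_mem (mul_mem genA_mem genB_mem) genA_mem) genB_mem

theorem gNormal_closure {S : Set (Equiv.Perm Ray)} (hS : S ⊆ grigorchuk)
    (h : ∀ g ∈ grigorchuk, ∀ s ∈ S, g * s * g⁻¹ ∈ S) : GNormal (Subgroup.closure S) where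
  le := (Subgroup.closure_le _).2 hS
  conj g hg n hn := by
    induction hn using Subgroup.closure_induction with
    | mem s hs => exact Subgroup.subset_closure (h g hg s hs)
    | one => simp
    | mul x y _ _ ihx ihy =>
      have : g * (x * y) * g⁻¹ = (g * x * g⁻¹) * (g * y * g⁻¹) := by group
      rw [this]; exact mul_mem ihx ihy
    | inv x _ ih =>
      have : g * x⁻¹ * g⁻¹ = (g * x * g⁻¹)⁻¹ := by group
      rw [this]; exact inv_mem ih

theorem gNormal_branchK : GNormal branchK := by
  refine gNormal_closure ?_ ?_
  · rintro _ ⟨g, hg, rfl⟩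
    exact mul_mem (mul_mem hg elemX_mem_grigorchuk) (inv_mem hg)
  · rintro h hh _ ⟨g, hg, rfl⟩
    exact ⟨h * g, mul_mem hh hg, by group⟩

theorem elemX_mem : elemX ∈ branchK :=
  Subgroup.subset_closure ⟨1, one_mem _, by simp⟩

theorem branchK_le {N : Subgroup (Equiv.Perm Ray)} (hx : ∀ g ∈ grigorchuk, g * elemX * g⁻¹ ∈ N) :
    branchK ≤ N := by
  refine (Subgroup.closure_le _).2 ?_
  rintro _ ⟨g, hg, rfl⟩
  exact hx g hg

/-- If `N` is normalized by `G` and contains `[K, G]`, then it contains `K × K`. -/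
theorem node_mem_of_commutator_mem {N : Subgroup (Equiv.Perm Ray)} (hN : GNormal N)
    (h : ∀ g ∈ grigorchuk, ∀ k ∈ branchK, ⁅g, k⁆ ∈ N) {k₀ k₁ : Equiv.Perm Ray}
    (hk₀ : k₀ ∈ branchK) (hk₁ : k₁ ∈ branchK) : node k₀ k₁ ∈ N := by
  -- Here x = (ab)² = (ca, ac) and d = (1, b), so the second section is [ac, b] = (ab)² again.
  have key : ⁅elemX, genD⁆ = node 1 elemX := by
    conv_lhs => rw [elemX_eq, genD_eq, commutatorElement_def, node_inv, node_inv, node_mul,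
      node_mul, node_mul]
    congr 1
    · group
    · exact commutator_ac_b
  have h1 : node 1 elemX ∈ N := by
    rw [← key, ← commutatorElement_inv]
    exact inv_mem (h _ genD_mem _ elemX_mem)
  have h2 : branchK ≤ N.comap
      ⟨⟨fun k => node 1 k, node_one⟩, fun x y => by simp [node_mul]⟩ := by
    refine branchK_le fun g hg => ?_
    -- Conjugating (1, x) by an element (s, g) of the group gives (1, gxg⁻¹), and every g occurs
    -- here.
    obtain ⟨s, -, hs⟩ := exists_node_left hg
    have := hN.conj _ (node_swap_mem hs) _ h1
    rwa [node_inv, node_mul, node_mul, mul_one, mul_inv_cancel] at this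
  have h3 : node 1 k₁ ∈ N := h2 hk₁
  have h4 : node 1 k₀ ∈ N := h2 hk₀
  have := mul_mem (hN.node_swap h4) h3
  rwa [node_mul, one_mul, mul_one] at this

/-- This is the regular branch property: normality already puts [K, G] into K. -/
theorem node_mem_branchK {k₀ k₁ : Equiv.Perm Ray} (hk₀ : k₀ ∈ branchK) (hk₁ : k₁ ∈ branchK) :
    node k₀ k₁ ∈ branchK :=
  node_mem_of_commutator_mem gNormal_branchK
    (fun _ hg _ hk => gNormal_branchK.commutator_mem' hk hg) hk₀ hk₁

/-! ### Level stabilizers and the branching subgroup -/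

/-- The permutations that preserve the first `n` letters of every ray. -/
def fixLevel (n : ℕ) : Subgroup (Equiv.Perm Ray) where
  carrier := {g | ∀ x, pre n (g x) = pre n x}
  mul_mem' {g h} hg hh x := (hg (h x)).trans (hh x)
  one_mem' _ := rfl
  inv_mem' {g} hg x := by simpa using (hg (g⁻¹ x)).symm

theorem mem_fixLevel {n : ℕ} {g : Equiv.Perm Ray} :
    g ∈ fixLevel n ↔ ∀ x, pre n (g x) = pre n x := Iff.rfl

theorem mem_levelStab {n : ℕ} {g : grigorchuk} :
    g ∈ levelStab n ↔ (g : Equiv.Perm Ray) ∈ fixLevel n := by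
  rw [levelStab, MonoidHom.mem_ker, mem_fixLevel]
  constructor
  · intro h x
    have := levelHom_pre n g x
    rw [h] at this
    exact this.symm
  · intro h
    ext1 v
    rw [← pre_ext n v, levelHom_pre]
    exact h _

theorem pre_succ_eq_iff {n : ℕ} {x y : Ray} :
    pre (n + 1) x = pre (n + 1) y ↔ x 0 = y 0 ∧ pre n (tail x) = pre n (tail y) := by
  simp only [pre_eq_iff]
  constructor
  · exact fun h => ⟨h 0 (by omega), fun i hi => h (i + 1) (by omega)⟩
  · rintro ⟨h0, h⟩ (_ | i) hi
    · exact h0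
    · exact h i (by omega)

theorem node_mem_fixLevel {n : ℕ} {g₀ g₁ : Equiv.Perm Ray} :
    node g₀ g₁ ∈ fixLevel (n + 1) ↔ g₀ ∈ fixLevel n ∧ g₁ ∈ fixLevel n := by
  simp only [mem_fixLevel, pre_succ_eq_iff, node_apply_zero, true_and, tail_node]
  constructor
  · intro h
    exact ⟨fun x => by simpa using h (cons false x), fun x => by simpa using h (cons true x)⟩
  · rintro ⟨h0, h1⟩ x
    split_ifs
    · exact h1 _
    · exact h0 _

theorem fixLevel_anti {m n : ℕ} (h : m ≤ n) : fixLevel n ≤ fixLevel m := fun g hg x => by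
  rw [pre_eq_iff]
  exact fun i hi => pre_eq_iff.1 (hg x) i (by omega)

theorem exists_node_of_mem_fixLevel {n : ℕ} {g : Equiv.Perm Ray} (hg : g ∈ grigorchuk)
    (h : g ∈ fixLevel (n + 1)) : ∃ g₀ ∈ grigorchuk, ∃ g₁ ∈ grigorchuk,
      g₀ ∈ fixLevel n ∧ g₁ ∈ fixLevel n ∧ g = node g₀ g₁ := by
  obtain ⟨g₀, h₀, g₁, h₁, rfl⟩ := exists_node_of_apply_zero (x := fun _ => false) hg
    (pre_succ_eq_iff.1 (h _)).1
  exact ⟨g₀, h₀, g₁, h₁, (node_mem_fixLevel.1 h).1, (node_mem_fixLevel.1 h).2, rfl⟩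

-- Signs on the levels and the quotient by K

/-- The sign of the action on level `n`. -/
def levelSign (n : ℕ) : grigorchuk →* ℤˣ := Equiv.Perm.sign.comp (levelHom n)

theorem levelSign_of_mem_fixLevel {n : ℕ} {g : grigorchuk} (h : (g : Equiv.Perm Ray) ∈ fixLevel n) :
    levelSign n g = 1 := by
  have : levelHom n g = 1 := mem_levelStab.2 h
  simp [levelSign, this]

/-- The generators as elements of the group. -/
abbrev gA : grigorchuk := ⟨genA, genA_mem⟩
abbrev gB : grigorchuk := ⟨genB, genB_mem⟩
abbrev gC : grigorchuk := ⟨genC, genC_mem⟩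
abbrev gD : grigorchuk := ⟨genD, genD_mem⟩

theorem levelSign_one_gens : levelSign 1 gA = -1 ∧ levelSign 1 gB = 1 ∧ levelSign 1 gD = 1 := by
  decide +kernel

theorem levelSign_two_gens : levelSign 2 gA = 1 ∧ levelSign 2 gB = -1 ∧ levelSign 2 gD = 1 := by
  decide +kernel

theorem levelSign_three_gens : levelSign 3 gA = 1 ∧ levelSign 3 gB = -1 ∧ levelSign 3 gC = 1 ∧
    levelSign 3 gD = -1 := by
  decide +kernel

/-- The subgroup `K` inside the group. -/
def kInG : Subgroup grigorchuk := branchK.subgroupOf grigorchuk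

instance : kInG.Normal where
  conj_mem n hn g := by
    rw [kInG, Subgroup.mem_subgroupOf] at hn ⊢
    exact gNormal_branchK.conj _ g.2 _ hn

/-- K is generated by conjugates of a square, and a character with values ±1 kills squares. So the
signs on the levels can tell cosets of K apart. -/
theorem map_eq_one_of_mem_kInG {χ : grigorchuk →* ℤˣ} {k : grigorchuk} (hk : k ∈ kInG) : χ k = 1 := by
  have : branchK ≤ (χ.ker).map grigorchuk.subtype := by
    refine branchK_le fun g hg => ⟨⟨g, hg⟩ * (gA * gB * gA * gB) * ⟨g, hg⟩⁻¹, ?_, rfl⟩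
    rw [SetLike.mem_coe, MonoidHom.mem_ker]
    simp only [map_mul, map_inv]
    rw [mul_comm (χ ⟨g, hg⟩), mul_inv_cancel_right, mul_assoc (χ gA * χ gB)]
    exact Int.units_mul_self _
  obtain ⟨k', hk', e⟩ := this hk
  have : k' = k := Subtype.ext e
  exact this ▸ hk'

/-- The hypotheses are relations that hold in G/K with t = (ad)²: t is central, and among the
generators a, b, d only a and d fail to commute, which costs a factor t. The generator c enters as
bd. -/
theorem exists_normal_form {Q : Type*} [Group Q] {a b d t : Q} (ha : a * a = 1) (hb : b * b = 1)
    (hd : d * d = 1) (hta : Commute t a) (htb : Commute t b) (htd : Commute t d)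
    (hab : Commute a b) (hbd : Commute b d) (hda : d * a = a * d * t) {q : Q}
    (hq : q ∈ Subgroup.closure {a, b, b * d, d}) :
    ∃ i j k l : ℕ, q = a ^ i * b ^ j * d ^ k * t ^ l := by
  have hdp : ∀ i : ℕ, d * a ^ i = a ^ i * d * t ^ i := by
    intro i
    induction i with
    | zero => simp
    | succ i ih =>
      rw [pow_succ, ← mul_assoc, ih, mul_assoc _ (t ^ i), (hta.pow_left i).eq, ← mul_assoc,
        mul_assoc _ d, hda, pow_succ' t]
      simp only [mul_assoc]
  have hdiv : ∀ y, (∃ i j k l : ℕ, y = a ^ i * b ^ j * d ^ k * t ^ l) →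
      ∃ i j k l : ℕ, d * y = a ^ i * b ^ j * d ^ k * t ^ l := by
    rintro _ ⟨i, j, k, l, rfl⟩
    refine ⟨i, j, k + 1, i + l, ?_⟩
    have h1 : t ^ i * b ^ j = b ^ j * t ^ i := ((htb.pow_left i).pow_right j).eq
    have h2 : t ^ i * d ^ k = d ^ k * t ^ i := ((htd.pow_left i).pow_right k).eq
    have h3 : d * b ^ j = b ^ j * d := (hbd.symm.pow_right j).eq
    calc d * (a ^ i * b ^ j * d ^ k * t ^ l) = d * a ^ i * b ^ j * d ^ k * t ^ l := by
          simp only [mul_assoc]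
      _ = a ^ i * d * (t ^ i * b ^ j) * d ^ k * t ^ l := by rw [hdp]; simp only [mul_assoc]
      _ = a ^ i * (d * b ^ j) * (t ^ i * d ^ k) * t ^ l := by rw [h1]; simp only [mul_assoc]
      _ = _ := by rw [h2, h3, pow_succ', pow_add]; simp only [mul_assoc]
  have hbiv : ∀ y, (∃ i j k l : ℕ, y = a ^ i * b ^ j * d ^ k * t ^ l) →
      ∃ i j k l : ℕ, b * y = a ^ i * b ^ j * d ^ k * t ^ l := by
    rintro _ ⟨i, j, k, l, rfl⟩
    refine ⟨i, j + 1, k, l, ?_⟩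
    rw [pow_succ', ← mul_assoc (a ^ i) b, ← (hab.symm.pow_right i).eq]
    simp only [mul_assoc]
  have hai : a⁻¹ = a := inv_eq_of_mul_eq_one_left ha
  have hbi : b⁻¹ = b := inv_eq_of_mul_eq_one_left hb
  have hdi : d⁻¹ = d := inv_eq_of_mul_eq_one_left hd
  have haiv : ∀ y, (∃ i j k l : ℕ, y = a ^ i * b ^ j * d ^ k * t ^ l) →
      ∃ i j k l : ℕ, a * y = a ^ i * b ^ j * d ^ k * t ^ l := by
    rintro _ ⟨i, j, k, l, rfl⟩
    exact ⟨i + 1, j, k, l, by rw [pow_succ']; simp only [mul_assoc]⟩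
  induction hq using Subgroup.closure_induction_left with
  | one => exact ⟨0, 0, 0, 0, by simp⟩
  | mul_left x hx y _ ih =>
    rcases hx with rfl | rfl | rfl | rfl
    · exact haiv _ ih
    · exact hbiv _ ih
    · rw [mul_assoc]; exact hbiv _ (hdiv _ ih)
    · exact hdiv _ ih
  | inv_mul_cancel x hx y _ ih =>
    rcases hx with rfl | rfl | rfl | rfl
    · rw [hai]; exact haiv _ ih
    · rw [hbi]; exact hbiv _ ih
    · rw [mul_inv_rev, hbi, hdi, mul_assoc]; exact hdiv _ (hbiv _ ih)
    · rw [hdi]; exact hdiv _ ih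

theorem closure_gens : Subgroup.closure {gA, gB, gB * gD, gD} = ⊤ := by
  have hC : gB * gD = gC := Subtype.ext genB_mul_genD
  rw [hC, eq_top_iff]
  intro g _
  have : grigorchuk ≤ (Subgroup.closure {gA, gB, gC, gD}).map grigorchuk.subtype :=
    grigorchuk_le ⟨gA, Subgroup.subset_closure (by simp), rfl⟩
      ⟨gB, Subgroup.subset_closure (by simp), rfl⟩ ⟨gC, Subgroup.subset_closure (by simp), rfl⟩
      ⟨gD, Subgroup.subset_closure (by simp), rfl⟩
  obtain ⟨g', hg', e⟩ := this g.2
  exact (Subtype.ext e : g' = g) ▸ hg'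

/-- The element `(ad)² = (b, b)`. -/
abbrev gT : grigorchuk := gA * gD * gA * gD

theorem gT_eq : (gT : Equiv.Perm Ray) = node genB genB := by
  show genA * genD * genA * genD = _
  rw [genD_eq, genA_conj_node, node_mul, mul_one, one_mul]

theorem gens_conj_elemX_mem : genB * genA * genB * genA ∈ branchK := by
  have : genB * genA * genB * genA = (genA * genB * genA * genB)⁻¹ := by
    simp only [mul_inv_rev, genA_inv, genB_inv, mul_assoc]
  rw [this]
  exact inv_mem elemX_mem

theorem exists_coset_form (g : grigorchuk) : ∃ i j k l : ℕ, ∃ κ ∈ kInG,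
    g = gA ^ i * gB ^ j * gD ^ k * gT ^ l * κ := by
  let π := QuotientGroup.mk' kInG
  have hcomm : ∀ u v : grigorchuk, ⁅(u : Equiv.Perm Ray), (v : Equiv.Perm Ray)⁆ ∈ branchK →
      Commute (π u) (π v) := by
    intro u v h
    rw [← commutatorElement_eq_one_iff_commute, ← map_commutatorElement]
    exact (QuotientGroup.eq_one_iff _).2 h
  have hone : ∀ k₀ ∈ branchK, node k₀ 1 ∈ branchK := fun k₀ h => node_mem_branchK h (one_mem _)
  have hgen : π g ∈ Subgroup.closure {π gA, π gB, π gB * π gD, π gD} := by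
    have h : g ∈ Subgroup.closure {gA, gB, gB * gD, gD} := closure_gens ▸ Subgroup.mem_top g
    have := Subgroup.mem_map_of_mem π h
    rw [MonoidHom.map_closure] at this
    simpa only [Set.image_insert_eq, Set.image_singleton, map_mul] using this
  obtain ⟨i, j, k, l, h⟩ := exists_normal_form (t := π gT)
    (by rw [← map_mul]; exact congrArg π (Subtype.ext genA_mul_self))
    (by rw [← map_mul]; exact congrArg π (Subtype.ext genB_mul_self))
    (by rw [← map_mul]; exact congrArg π (Subtype.ext genD_mul_self))
    -- The relations modulo K: a swaps the equal sections of t = (b, b); [t, b] = (baba, 1) lies in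
    -- K × 1; t and d commute; [a, b] = (ab)²; b and d commute; and da = ad(ad)² since (ad)⁴ = 1.
    (hcomm _ _ (by
      rw [gT_eq, commutatorElement_def, genA_inv, node_inv, mul_assoc, mul_assoc,
        ← mul_assoc genA, genA_conj_node, node_mul, mul_inv_cancel, node_one]
      exact one_mem _))
    (hcomm _ _ (by
      rw [gT_eq]
      have : ⁅node genB genB, genB⁆ = node (genB * genA * genB * genA) 1 := by
        conv_lhs => rw [commutatorElement_def, genB_inv]
                    enter [1, 1, 2]
                    rw [genB_eq]
        conv_lhs => enter [2]
                    rw [genB_eq]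
        rw [node_inv, node_mul, node_mul, node_mul, genB_inv, genB_mul_genC, genD_mul_genB,
          genC_mul_self]
      rw [this]
      exact hone _ gens_conj_elemX_mem))
    (hcomm _ _ (by
      rw [gT_eq, show ((gD : grigorchuk) : Equiv.Perm Ray) = genD from rfl, commutatorElement_def,
        genD_inv, genD_eq, node_inv, node_mul, node_mul, node_mul,
        genB_inv, genB_mul_self]
      simp only [mul_one, one_mul, genB_mul_self, node_one]
      exact one_mem _))
    (hcomm _ _ (by
      rw [commutatorElement_def, genA_inv, genB_inv]; exact elemX_mem))
    (hcomm _ _ (by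
      rw [commutatorElement_def, genD_inv, genB_inv, genB_mul_genD, genC_mul_genB, genD_mul_self]
      exact one_mem _))
    (by
      rw [← map_mul, ← map_mul, ← map_mul]
      refine congrArg π (Subtype.ext ?_)
      show genD * genA = genA * genD * (genA * genD * genA * genD)
      have ht : (genA * genD * genA * genD) * (genA * genD * genA * genD) = 1 := by
        have := gT_eq
        change genA * genD * genA * genD = _ at this
        rw [this, node_mul, genB_mul_self, node_one]
      calc genD * genA = (genA * genD)⁻¹ := by rw [mul_inv_rev, genA_inv, genD_inv]
        _ = _ := by
          rw [inv_eq_iff_mul_eq_one, ← ht]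
          simp only [mul_assoc])
    hgen
  refine ⟨i, j, k, l, (gA ^ i * gB ^ j * gD ^ k * gT ^ l)⁻¹ * g, ?_, by group⟩
  rw [← QuotientGroup.eq]
  simp only [QuotientGroup.mk_mul, QuotientGroup.mk_pow]
  simp only [π, map_mul, QuotientGroup.mk'_apply] at h
  exact h.symm

theorem map_conj_mul_eq_one {χ : grigorchuk →* ℤˣ} {g u v : grigorchuk} (hu : χ u = 1)
    (hv : χ v = 1) : χ (g * (u * v) * g⁻¹) = 1 := by
  rw [map_mul, map_mul, map_mul, hu, hv, mul_one, mul_one, map_inv, mul_inv_cancel]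

/-- The sections of (ab)² are ca and ac, and both a and c act evenly on level 3. This separates K
from the coset of (ad)² = (b, b), as b is odd there; characters of the whole group cannot, since
they kill the square (ad)². -/
theorem branchK_sections {k : Equiv.Perm Ray} (hk : k ∈ branchK) :
    ∃ k₀ k₁ : grigorchuk, k = node k₀ k₁ ∧ levelSign 3 k₀ = 1 ∧ levelSign 3 k₁ = 1 := by
  have hac : levelSign 3 gA = 1 ∧ levelSign 3 gC = 1 :=
    ⟨levelSign_three_gens.1, levelSign_three_gens.2.2.1⟩
  induction hk using Subgroup.closure_induction with
  | mem k hk =>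
    obtain ⟨g, hg, rfl⟩ := hk
    obtain ⟨g₀, hg₀, g₁, hg₁, rfl | rfl⟩ := exists_sections hg
    · refine ⟨⟨g₀, hg₀⟩ * (gC * gA) * ⟨g₀, hg₀⟩⁻¹, ⟨g₁, hg₁⟩ * (gA * gC) * ⟨g₁, hg₁⟩⁻¹, ?_, ?_, ?_⟩
      · show node g₀ g₁ * elemX * _ = _
        rw [elemX_eq, node_inv, node_mul, node_mul]; rfl
      · exact map_conj_mul_eq_one hac.2 hac.1
      · exact map_conj_mul_eq_one hac.1 hac.2
    · refine ⟨⟨g₀, hg₀⟩ * (gA * gC) * ⟨g₀, hg₀⟩⁻¹, ⟨g₁, hg₁⟩ * (gC * gA) * ⟨g₁, hg₁⟩⁻¹, ?_, ?_, ?_⟩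
      · show node g₀ g₁ * genA * elemX * _ = _
        rw [elemX_eq, mul_inv_rev, mul_assoc (node g₀ g₁), genA_mul_node, mul_assoc, mul_assoc,
          mul_inv_cancel_left, node_inv, node_mul, node_mul, ← mul_assoc, ← mul_assoc]; rfl
      · exact map_conj_mul_eq_one hac.1 hac.2
      · exact map_conj_mul_eq_one hac.2 hac.1
  | one => exact ⟨1, 1, node_one.symm, map_one _, map_one _⟩
  | mul x y _ _ ihx ihy =>
    obtain ⟨x₀, x₁, rfl, h₀, h₁⟩ := ihx
    obtain ⟨y₀, y₁, rfl, h₀', h₁'⟩ := ihy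
    exact ⟨x₀ * y₀, x₁ * y₁, node_mul _ _ _ _, by simp [h₀, h₀'], by simp [h₁, h₁']⟩
  | inv x _ ih =>
    obtain ⟨x₀, x₁, rfl, h₀, h₁⟩ := ih
    exact ⟨x₀⁻¹, x₁⁻¹, node_inv _ _, by simp [h₀], by simp [h₁]⟩

theorem even_of_neg_one_pow {n : ℕ} (h : (-1 : ℤˣ) ^ n = 1) : Even n := by
  by_contra hn
  rw [Nat.not_even_iff_odd] at hn
  rw [hn.neg_one_pow] at h
  exact absurd h (by decide)

theorem pow_eq_one_of_even {G : Type*} [Group G] {g : G} (hg : g * g = 1) {n : ℕ} (hn : Even n) :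
    g ^ n = 1 := by
  obtain ⟨m, rfl⟩ := hn
  rw [← two_mul, pow_mul, pow_two, hg, one_pow]

/-- `K` contains the stabilizer of level `4`. -/
theorem inf_fixLevel_four_le : grigorchuk ⊓ fixLevel 4 ≤ branchK := by
  rintro g ⟨hg, hg4⟩
  obtain ⟨i, j, k, l, κ, hκ, e⟩ := exists_coset_form ⟨g, hg⟩
  have hs : ∀ n ≤ 4, levelSign n ⟨g, hg⟩ = 1 := fun n hn =>
    levelSign_of_mem_fixLevel (fixLevel_anti hn hg4)
  have ht : ∀ n, levelSign n gT = 1 := by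
    intro n
    rw [gT, mul_assoc (gA * gD), map_mul]
    exact Int.units_mul_self _
  obtain ⟨a1, b1, d1⟩ := levelSign_one_gens
  obtain ⟨a2, b2, d2⟩ := levelSign_two_gens
  obtain ⟨a3, b3, -, d3⟩ := levelSign_three_gens
  -- The signs on levels 1, 2, 3 give the parities of the exponents of a, b, d in turn.
  have s1 := hs 1 (by norm_num)
  have s2 := hs 2 (by norm_num)
  have s3 := hs 3 (by norm_num)
  rw [e] at s1 s2 s3
  simp only [map_mul, map_pow, ht, map_eq_one_of_mem_kInG hκ, one_pow, mul_one, a1, b1, d1, a2, b2, d2, a3,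
    b3, d3, one_mul] at s1 s2 s3
  have hi := even_of_neg_one_pow s1
  have hj := even_of_neg_one_pow s2
  rw [hj.neg_one_pow, one_mul] at s3
  have hk := even_of_neg_one_pow s3
  rw [pow_eq_one_of_even (Subtype.ext genA_mul_self) hi,
    pow_eq_one_of_even (Subtype.ext genB_mul_self) hj,
    pow_eq_one_of_even (Subtype.ext genD_mul_self) hk] at e
  simp only [one_mul] at e
  have htt : gT * gT = 1 := Subtype.ext (by
    show (gT : Equiv.Perm Ray) * gT = 1
    rw [gT_eq, node_mul, genB_mul_self, node_one])
  rcases Nat.even_or_odd l with hl | ⟨m, rfl⟩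
  · rw [pow_eq_one_of_even htt hl, one_mul] at e
    have := congrArg Subtype.val e
    change g = κ at this
    rw [this]
    exact hκ
  -- For odd exponent of t, the left section of g would be b times an even element on level 3, hence
  -- odd, although it must fix level 3.
  · rw [pow_succ, pow_mul, pow_two, htt, one_pow, one_mul] at e
    obtain ⟨κ₀, κ₁, e', h₀, -⟩ := branchK_sections hκ
    have e2 : g = node (gB * κ₀ : grigorchuk) (gB * κ₁ : grigorchuk) := by
      have := congrArg Subtype.val e
      change g = (gT : Equiv.Perm Ray) * κ at this
      rw [this, gT_eq, show (κ : Equiv.Perm Ray) = _ from e', node_mul]; rfl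
    rw [e2] at hg4
    replace hg4 := node_mem_fixLevel.1 hg4
    have := levelSign_of_mem_fixLevel hg4.1
    rw [map_mul, h₀, mul_one, b3] at this
    exact absurd this (by decide)

/-! ### Congruence subgroups -/

/-- The permutations acting on the rays through `i` by `k` and trivially on the others. -/
def nodeAt (i : Bool) : Equiv.Perm Ray →* Equiv.Perm Ray where
  toFun k := if i then node 1 k else node k 1
  map_one' := by simp [node_one]
  map_mul' k l := by cases i <;> simp [node_mul]

/-- The permutation acting on the rays through `v` by `k` and trivially on the others. -/
def graft : List Bool → Equiv.Perm Ray →* Equiv.Perm Ray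
  | [] => MonoidHom.id _
  | i :: v => (nodeAt i).comp (graft v)

theorem graft_cons (i : Bool) (v : List Bool) (k : Equiv.Perm Ray) :
    graft (i :: v) k = nodeAt i (graft v k) := rfl

theorem graft_append (v w : List Bool) (k : Equiv.Perm Ray) :
    graft (v ++ w) k = graft v (graft w k) := by
  induction v with
  | nil => rfl
  | cons i v ih => rw [List.cons_append, graft_cons, graft_cons, ih]

theorem mem_cylinder_nil (x : Ray) : x ∈ cylinder [] := fun i h => absurd h (by simp)

theorem mem_cylinder_cons {i : Bool} {v : List Bool} {x : Ray} :
    x ∈ cylinder (i :: v) ↔ x 0 = i ∧ tail x ∈ cylinder v := by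
  constructor
  · exact fun h => ⟨h 0 (by simp), fun j hj => h (j + 1) (by simpa using hj)⟩
  · rintro ⟨h0, h⟩ (_ | j) hj
    · exact h0
    · exact h j (by simpa using hj)

theorem nodeAt_apply_zero (i : Bool) (k : Equiv.Perm Ray) (x : Ray) : nodeAt i k x 0 = x 0 := by
  cases i <;> rfl

theorem tail_nodeAt (i : Bool) (k : Equiv.Perm Ray) (x : Ray) :
    tail (nodeAt i k x) = if x 0 = i then k (tail x) else tail x := by
  cases i <;> cases h : x 0 <;> simp [nodeAt, tail_node, h]

theorem nodeAt_injective (i : Bool) : Function.Injective (nodeAt i) := by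
  intro k l h
  ext1 x
  have := congrArg tail (DFunLike.congr_fun h (cons i x))
  simpa [tail_nodeAt] using this

theorem graft_injective (v : List Bool) : Function.Injective (graft v) := by
  induction v with
  | nil => exact fun _ _ h => h
  | cons i v ih => exact (nodeAt_injective i).comp ih

theorem graft_apply_of_notMem {v : List Bool} (k : Equiv.Perm Ray) {x : Ray}
    (hx : x ∉ cylinder v) : graft v k x = x := by
  induction v generalizing x with
  | nil => exact absurd (mem_cylinder_nil x) hx
  | cons i v ih =>
    rw [graft_cons]
    refine ray_ext (nodeAt_apply_zero _ _ _) ?_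
    rw [tail_nodeAt]
    split_ifs with h
    · exact ih fun h' => hx (mem_cylinder_cons.2 ⟨h, h'⟩)
    · rfl

/-- An element of the group supported under a vertex is grafted from an element of the group. -/
theorem exists_graft {v : List Bool} {g : Equiv.Perm Ray} (hg : g ∈ grigorchuk)
    (h : ∀ x ∉ cylinder v, g x = x) : ∃ k ∈ grigorchuk, g = graft v k := by
  induction v generalizing g with
  | nil => exact ⟨g, hg, rfl⟩
  | cons i v ih =>
    have h1 : g (cons (!i) fun _ => false) = cons (!i) fun _ => false :=
      h _ fun h' => by simpa using (mem_cylinder_cons.1 h').1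
    obtain ⟨g₀, hg₀, g₁, hg₁, rfl⟩ := exists_node_of_apply_zero hg (congrFun h1 0)
    have h0 : ∀ j x, (j = i → x ∉ cylinder v) → (if j then g₁ else g₀) x = x := by
      intro j x hx
      have := congrArg tail (h (cons j x) fun h' =>
        hx (mem_cylinder_cons.1 h').1 (mem_cylinder_cons.1 h').2)
      rw [tail_node] at this
      cases j <;> simpa using this
    cases i
    · have e : g₁ = 1 := Equiv.ext fun x => h0 true x (by simp)
      obtain ⟨k, hk, rfl⟩ := ih hg₀ fun x hx => h0 false x fun _ => hx
      exact ⟨k, hk, by rw [e]; rfl⟩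
    · have e : g₀ = 1 := Equiv.ext fun x => h0 false x (by simp)
      obtain ⟨k, hk, rfl⟩ := ih hg₁ fun x hx => h0 true x fun _ => hx
      exact ⟨k, hk, by rw [e]; rfl⟩

theorem graft_mem_branchK (v : List Bool) {k : Equiv.Perm Ray} (hk : k ∈ branchK) :
    graft v k ∈ branchK := by
  induction v with
  | nil => exact hk
  | cons i v ih =>
    rw [graft_cons]
    cases i
    · exact node_mem_branchK ih (one_mem _)
    · exact node_mem_branchK (one_mem _) ih

/-- The elements of the group whose copies at the first level lie in `N`. -/
def descend (N : Subgroup (Equiv.Perm Ray)) : Subgroup (Equiv.Perm Ray) :=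
  grigorchuk ⊓ N.comap (nodeAt false)

theorem mem_descend {N : Subgroup (Equiv.Perm Ray)} {g : Equiv.Perm Ray} :
    g ∈ descend N ↔ g ∈ grigorchuk ∧ node g 1 ∈ N := Iff.rfl

theorem GNormal.descend {N : Subgroup (Equiv.Perm Ray)} (hN : GNormal N) : GNormal (descend N) where
  le := inf_le_left
  conj g hg n hn := by
    refine mem_descend.2 ⟨mul_mem (mul_mem hg (mem_descend.1 hn).1) (inv_mem hg), ?_⟩
    obtain ⟨h, -, hh⟩ := exists_node_left hg
    have := hN.conj _ hh _ (mem_descend.1 hn).2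
    rwa [node_inv, node_mul, node_mul, mul_one, mul_inv_cancel] at this

/-- Conjugation by a exchanges the two subtrees, so only the length of v matters and `descend` may
look at left copies alone. -/
theorem mem_descend_iterate {N : Subgroup (Equiv.Perm Ray)} (hN : GNormal N) {v : List Bool}
    {k : Equiv.Perm Ray} (hk : k ∈ branchK) (h : graft v k ∈ N) : k ∈ descend^[v.length] N := by
  induction v generalizing N with
  | nil => exact h
  | cons i v ih =>
    refine ih hN.descend (mem_descend.2 ⟨gNormal_branchK.le (graft_mem_branchK v hk), ?_⟩)
    rw [graft_cons] at h
    cases i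
    · exact h
    · exact hN.node_swap h

/-- An element of St(n + 1) is the product of a left and a right copy of its sections in St(n), and
the right copy is an a-conjugate of a left copy. -/
theorem inf_fixLevel_le_of_descend {N : Subgroup (Equiv.Perm Ray)} (hN : GNormal N) {m l : ℕ}
    (h : grigorchuk ⊓ fixLevel m ≤ descend^[l] N) : grigorchuk ⊓ fixLevel (m + l) ≤ N := by
  induction l generalizing N with
  | zero => exact h
  | succ l ih =>
    rintro g ⟨hg, hg'⟩
    obtain ⟨g₀, h₀, g₁, h₁, f₀, f₁, rfl⟩ := exists_node_of_mem_fixLevel (n := m + l) hg hg'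
    have h2 := ih hN.descend h
    have := mul_mem (mem_descend.1 (h2 ⟨h₀, f₀⟩)).2
      (hN.node_swap (mem_descend.1 (h2 ⟨h₁, f₁⟩)).2)
    simpa [node_mul] using this

-- The derived subgroup of K

theorem gNormal_commutator_branchK : GNormal ⁅branchK, branchK⁆ := by
  refine gNormal_closure ?_ ?_
  · rintro _ ⟨k, hk, l, hl, rfl⟩
    exact gNormal_branchK.le (gNormal_branchK.commutator_mem hk (gNormal_branchK.le hl))
  · rintro g hg _ ⟨k, hk, l, hl, rfl⟩
    refine ⟨_, gNormal_branchK.conj g hg k hk, _, gNormal_branchK.conj g hg l hl, ?_⟩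
    simp only [commutatorElement_def]; group

/-- The elements of the group whose commutators with `K` lie in `N`. -/
def commutesMod {N : Subgroup (Equiv.Perm Ray)} (hN : GNormal N) : Subgroup (Equiv.Perm Ray) where
  carrier := {g | g ∈ grigorchuk ∧ ∀ k ∈ branchK, ⁅g, k⁆ ∈ N}
  one_mem' := ⟨one_mem _, fun k _ => by rw [commutatorElement_one_left]; exact one_mem _⟩
  mul_mem' {g h} hg hh := by
    refine ⟨mul_mem hg.1 hh.1, fun k hk => ?_⟩
    have : ⁅g * h, k⁆ = g * ⁅h, k⁆ * g⁻¹ * ⁅g, k⁆ := by simp only [commutatorElement_def]; group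
    rw [this]
    exact mul_mem (hN.conj _ hg.1 _ (hh.2 k hk)) (hg.2 k hk)
  inv_mem' {g} hg := by
    refine ⟨inv_mem hg.1, fun k hk => ?_⟩
    have : ⁅g⁻¹, k⁆ = g⁻¹ * ⁅g, k⁆⁻¹ * g⁻¹⁻¹ := by simp only [commutatorElement_def]; group
    rw [this]
    exact hN.conj _ (inv_mem hg.1) _ (inv_mem (hg.2 k hk))

theorem gNormal_commutesMod {N : Subgroup (Equiv.Perm Ray)} (hN : GNormal N) :
    GNormal (commutesMod hN) where
  le _ h := h.1
  conj g hg n hn := by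
    refine ⟨mul_mem (mul_mem hg hn.1) (inv_mem hg), fun k hk => ?_⟩
    have : ⁅g * n * g⁻¹, k⁆ = g * ⁅n, g⁻¹ * k * g⁻¹⁻¹⁆ * g⁻¹ := by
      simp only [commutatorElement_def]; group
    rw [this]
    exact hN.conj _ hg _ (hn.2 _ (gNormal_branchK.conj _ (inv_mem hg) _ hk))

/-- Since (k, 1) ∈ K, the commutator of (g₀, g₁) with it, which is ([g₀, k], 1), lies in N. -/
theorem mem_commutesMod_descend {N : Subgroup (Equiv.Perm Ray)} (hN : GNormal N)
    {g₀ g₁ : Equiv.Perm Ray} (h : node g₀ g₁ ∈ commutesMod hN) :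
    g₀ ∈ commutesMod hN.descend := by
  have hg := (sections_of_node_mem h.1).1
  refine ⟨hg, fun k hk => mem_descend.2
    ⟨gNormal_branchK.le (gNormal_branchK.commutator_mem' hk hg), ?_⟩⟩
  have := h.2 _ (node_mem_branchK hk (one_mem _))
  rw [commutatorElement_def, node_inv, node_inv, node_mul, node_mul, node_mul] at this
  simpa [commutatorElement_def] using this

/-- The derived subgroup of `K` contains the stabilizer of level `8`. -/
theorem inf_fixLevel_eight_le : grigorchuk ⊓ fixLevel 8 ≤ ⁅branchK, branchK⁆ := by
  have hN := gNormal_commutator_branchK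
  set N : Subgroup (Equiv.Perm Ray) := ⁅branchK, branchK⁆ with hNdef
  have sq : genC * genA * (genC * genA) = node (genA * genD) (genD * genA) := by
    rw [mul_assoc, ← mul_assoc genA]
    conv_lhs => rw [genC_eq]
    rw [genA_conj_node, node_mul]
  have cj : (genC * genA)⁻¹ * (genB * (genC * genA) * genB⁻¹) = elemX := by
    rw [mul_inv_rev, genA_inv, genC_inv, genB_inv]
    simp only [mul_assoc, mul_reassoc genB_mul_genC, mul_reassoc genC_mul_genD]
  -- Start from x = (ab)² ∈ K, which commutes with K modulo K'. One level down the left section ca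
  -- does; conjugating it by b recovers x at that level, and (ca)² = (ad, da) supplies ad on the
  -- next. At depth 2, ca · ad = b; at depth 3, b yields a, and then c and d follow. So at depth 3
  -- all of G commutes with K modulo the descended K'.
  have x0 : elemX ∈ commutesMod hN :=
    ⟨elemX_mem_grigorchuk, fun k hk => Subgroup.commutator_mem_commutator elemX_mem hk⟩
  have step : ∀ {M : Subgroup (Equiv.Perm Ray)} (hM : GNormal M), elemX ∈ commutesMod hM →
      genC * genA ∈ commutesMod hM.descend := fun hM h =>
    mem_commutesMod_descend hM (elemX_eq ▸ h)
  have step' : ∀ {M : Subgroup (Equiv.Perm Ray)} (hM : GNormal M),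
      genC * genA ∈ commutesMod hM → elemX ∈ commutesMod hM ∧
        genA * genD ∈ commutesMod hM.descend := fun hM h =>
    ⟨cj ▸ mul_mem (inv_mem h) ((gNormal_commutesMod hM).conj _ genB_mem _ h),
      mem_commutesMod_descend hM (sq ▸ mul_mem h h)⟩
  have c1 := step hN x0
  obtain ⟨x1, d2⟩ := step' _ c1
  have c2 := step _ x1
  obtain ⟨x2, d3⟩ := step' _ c2
  have c3 := step _ x2
  have b2 : genB ∈ commutesMod hN.descend.descend := by
    have := mul_mem c2 d2
    rwa [mul_assoc, ← mul_assoc genA, genA_mul_self, one_mul, genC_mul_genD] at this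
  have a3 : genA ∈ commutesMod hN.descend.descend.descend :=
    mem_commutesMod_descend _ (genB_eq ▸ b2)
  have cc3 : genC ∈ commutesMod hN.descend.descend.descend := by
    have := mul_mem c3 a3
    rwa [mul_assoc, genA_mul_self, mul_one] at this
  have dd3 : genD ∈ commutesMod hN.descend.descend.descend := by
    have := mul_mem a3 d3
    rwa [← mul_assoc, genA_mul_self, one_mul] at this
  have bb3 : genB ∈ commutesMod hN.descend.descend.descend := by
    have := mul_mem cc3 dd3
    rwa [genC_mul_genD] at this
  have all := grigorchuk_le a3 bb3 cc3 dd3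
  -- St(5) has sections in St(4) ≤ K, so it lies in K × K; three levels of descent then give 8.
  refine inf_fixLevel_le_of_descend (m := 5) (l := 3) hN ?_
  rintro g ⟨hg, hg'⟩
  obtain ⟨g₀, h₀, g₁, h₁, f₀, f₁, rfl⟩ := exists_node_of_mem_fixLevel (n := 4) hg hg'
  exact node_mem_of_commutator_mem hN.descend.descend.descend (fun s hs k hk => (all hs).2 k hk)
    (inf_fixLevel_four_le ⟨h₀, f₀⟩) (inf_fixLevel_four_le ⟨h₁, f₁⟩)

/-! ### Cylinders -/

/-- The vertex of level `n` on a ray. -/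
def vertex (n : ℕ) (x : Ray) : List Bool := List.ofFn (pre n x)

@[simp] theorem length_vertex (n : ℕ) (x : Ray) : (vertex n x).length = n := by simp [vertex]

theorem mem_cylinder_vertex {n : ℕ} {x y : Ray} :
    y ∈ cylinder (vertex n x) ↔ pre n y = pre n x := by
  rw [pre_eq_iff]
  simp [cylinder, vertex, pre]

theorem self_mem_cylinder_vertex (n : ℕ) (x : Ray) : x ∈ cylinder (vertex n x) :=
  mem_cylinder_vertex.2 rfl

theorem cylinder_eq_of_mem {v : List Bool} {x : Ray} (h : x ∈ cylinder v) :
    v = vertex v.length x := by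
  refine List.ext_getElem (by simp) fun i h1 h2 => ?_
  simp [vertex, pre, h i h1]

theorem cylinder_nonempty (v : List Bool) : (cylinder v).Nonempty :=
  ⟨fun i => if h : i < v.length then v[i] else false, fun i h => by simp [h]⟩

theorem cylinder_append_subset (v w : List Bool) : cylinder (v ++ w) ⊆ cylinder v := by
  intro x hx i hi
  rw [hx i (by simp; omega), List.getElem_append_left hi]

/-- Conjugation moves supports. -/
theorem conj_apply_of_notMem {g k : Equiv.Perm Ray} {U : Set Ray} (hk : ∀ x ∉ U, k x = x) {x : Ray}
    (hx : g⁻¹ x ∉ U) : (g * k * g⁻¹) x = x := by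
  rw [Equiv.Perm.mul_apply, Equiv.Perm.mul_apply, hk _ hx]
  exact g.apply_symm_apply x

theorem perm_commute_of_disjoint {f g : Equiv.Perm Ray} {U V : Set Ray} (hUV : Disjoint U V)
    (hf : ∀ x ∉ U, f x = x) (hg : ∀ x ∉ V, g x = x) : Commute f g :=
  Equiv.Perm.Disjoint.commute fun x => by
    by_cases hx : x ∈ U
    · exact .inr (hg x (Set.disjoint_left.1 hUV hx))
    · exact .inl (hf x hx)

-- Normal subgroups and the congruence subgroup property

theorem commutator_commutator_of_commute {G : Type*} [Group G] {u k l : G} (huk : Commute u k)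
    (hul : Commute u l) : ⁅u * k⁻¹, l⁆ = ⁅k⁻¹, l⁆ := by
  have h : Commute u (k⁻¹ * l * k) := (huk.inv_right.mul_right hul).mul_right huk
  rw [commutatorElement_def, commutatorElement_def, mul_inv_rev, inv_inv]
  calc u * k⁻¹ * l * (k * u⁻¹) * l⁻¹ = u * (k⁻¹ * l * k) * u⁻¹ * l⁻¹ := by group
    _ = _ := by rw [h.eq, mul_inv_cancel_right]

/-- If n ∈ N moves the cylinder of v off itself and k, l are copies at v of elements of K, then [[n,
k⁻¹], l] = [k, l], because nk⁻¹n⁻¹ is supported elsewhere. So N contains the copy of K' at v, hence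
by normality a level stabilizer. -/
theorem exists_inf_fixLevel_le {N : Subgroup (Equiv.Perm Ray)} (hN : GNormal N) (h : N ≠ ⊥) :
    ∃ m, grigorchuk ⊓ fixLevel m ≤ N := by
  obtain ⟨n, hn, hn1⟩ := (Subgroup.bot_or_exists_ne_one N).resolve_left h
  obtain ⟨x, hx⟩ : ∃ x, n x ≠ x := by
    by_contra! h
    exact hn1 (Equiv.ext h)
  obtain ⟨i, hi⟩ := Function.ne_iff.1 hx
  set v := vertex (i + 1) x
  have hdisj : ∀ y, n⁻¹ y ∈ cylinder v → y ∉ cylinder v := by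
    intro y hy hy'
    rw [mem_cylinder_vertex] at hy hy'
    have h1 := (pre_smul_aux (hN.le hn) (i + 1) _ _).2 hy
    rw [show n (n⁻¹ y) = y from n.apply_symm_apply y, hy'] at h1
    exact hi (pre_eq_iff.1 h1 i (by omega)).symm
  have key : ⁅branchK, branchK⁆ ≤ N.comap (graft v) := by
    rw [Subgroup.commutator_le]
    intro k hk l hl
    rw [Subgroup.mem_comap, map_commutatorElement]
    have hkG := gNormal_branchK.le (graft_mem_branchK v hk)
    have hlG := gNormal_branchK.le (graft_mem_branchK v hl)
    have hc : ∀ j, Commute (n * (graft v k)⁻¹ * n⁻¹) (graft v j) := fun j =>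
      perm_commute_of_disjoint (U := {y | n⁻¹ y ∈ cylinder v}) (V := cylinder v)
        (Set.disjoint_left.2 hdisj)
        (fun y hy => conj_apply_of_notMem (U := cylinder v)
          (fun z hz => by rw [← map_inv]; exact graft_apply_of_notMem _ hz) hy)
        (fun y hy => graft_apply_of_notMem _ hy)
    have := hN.commutator_mem (hN.commutator_mem hn (inv_mem hkG)) hlG
    have e : ⁅n, (graft v k)⁻¹⁆ = n * (graft v k)⁻¹ * n⁻¹ * (graft v k⁻¹)⁻¹ := by
      rw [commutatorElement_def, map_inv]
    rw [e, commutator_commutator_of_commute (hc _) (hc _), map_inv, inv_inv] at this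
    exact this
  refine ⟨8 + v.length, inf_fixLevel_le_of_descend hN fun g hg => ?_⟩
  have hg' := inf_fixLevel_eight_le hg
  have hgK : g ∈ branchK :=
    inf_fixLevel_four_le ⟨hg.1, fixLevel_anti (by norm_num) hg.2⟩
  exact mem_descend_iterate hN hgK (key hg')

/-- Both sections ca and ac change their first letter, so (ab)² changes the second letter of every
ray. -/
theorem elemX_apply_ne (x : Ray) : elemX x ≠ x := by
  intro h
  rw [elemX_eq] at h
  have h1 := congrFun (congrArg tail h) 0
  rw [tail_node] at h1
  have hC : ∀ y, genC y 0 = y 0 := fun y => rfl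
  split_ifs at h1 <;> simp [Equiv.Perm.mul_apply, hC, genA_apply_zero] at h1

theorem graft_replicate_ne (m l : ℕ) : graft (List.replicate m false) elemX ≠
    graft (List.replicate (m + (l + 1)) false) elemX := by
  intro e
  rw [List.replicate_add, graft_append] at e
  have e' := DFunLike.congr_fun (graft_injective _ e) fun _ => true
  rw [graft_apply_of_notMem (v := List.replicate (l + 1) false)] at e'
  · exact elemX_apply_ne _ e'
  · rw [List.replicate_succ, mem_cylinder_cons]
    exact fun h => absurd h.1 (by simp)

theorem infinite_grigorchuk : (grigorchuk : Set (Equiv.Perm Ray)).Infinite := by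
  refine Set.infinite_of_injective_forall_mem
    (f := fun n => graft (List.replicate n false) elemX) (fun m n h => ?_)
    fun n => gNormal_branchK.le (graft_mem_branchK _ elemX_mem)
  rcases lt_trichotomy m n with h' | h' | h'
  · obtain ⟨l, rfl⟩ := Nat.exists_eq_add_of_lt h'
    exact absurd h (graft_replicate_ne m l)
  · exact h'
  · obtain ⟨l, rfl⟩ := Nat.exists_eq_add_of_lt h'
    exact absurd h.symm (graft_replicate_ne n l)

instance : Infinite grigorchuk := infinite_grigorchuk.to_subtype

theorem gNormal_map_subtype (N : Subgroup grigorchuk) [N.Normal] :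
    GNormal (N.map grigorchuk.subtype) where
  le := Subgroup.map_subtype_le _
  conj := by
    rintro g hg _ ⟨n, hn, rfl⟩
    exact ⟨⟨g, hg⟩ * n * ⟨g, hg⟩⁻¹, Subgroup.Normal.conj_mem inferInstance n hn _, rfl⟩

theorem normalCore_ne_bot (F : Subgroup grigorchuk) [F.FiniteIndex] : F.normalCore ≠ ⊥ := by
  intro h
  have h1 : F.normalCore.index ≠ 0 := Subgroup.FiniteIndex.index_ne_zero
  rw [h, Subgroup.index_bot] at h1
  exact h1 Nat.card_eq_zero_of_infinite

/-- The congruence subgroup property. -/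
theorem exists_levelStab_le (F : Subgroup grigorchuk) [F.FiniteIndex] : ∃ m, levelStab m ≤ F := by
  obtain ⟨m, hm⟩ := exists_inf_fixLevel_le (gNormal_map_subtype F.normalCore)
    (by
      rw [Ne, Subgroup.map_eq_bot_iff_of_injective _ grigorchuk.subtype_injective]
      exact normalCore_ne_bot F)
  refine ⟨m, fun g hg => F.normalCore_le ?_⟩
  have : (g : Equiv.Perm Ray) ∈ F.normalCore.map grigorchuk.subtype :=
    hm ⟨g.2, mem_levelStab.1 hg⟩
  exact (Subgroup.mem_map_iff_mem grigorchuk.subtype_injective).1 this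

/-! ### Rigid stabilizers -/

theorem mem_rigidStab {U : Set Ray} {g : grigorchuk} :
    g ∈ rigidStab U ↔ ∀ x ∉ U, g • x = x := by
  rw [rigidStab, mem_fixingSubgroup_iff]; rfl

theorem rigidStab_mono {U V : Set Ray} (h : U ⊆ V) : rigidStab U ≤ rigidStab V := fun _ hg =>
  mem_rigidStab.2 fun x hx => mem_rigidStab.1 hg x fun h' => hx (h h')

theorem commute_of_mem_rigidStab {U V : Set Ray} (hUV : Disjoint U V) {f g : grigorchuk}
    (hf : f ∈ rigidStab U) (hg : g ∈ rigidStab V) : Commute f g :=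
  Subtype.ext (perm_commute_of_disjoint hUV (mem_rigidStab.1 hf) (mem_rigidStab.1 hg)).eq

theorem rigidStab_le_rist {m : ℕ} {v w : List Bool} (h : m ≤ w.length) :
    rigidStab (cylinder (v ++ w)) ≤ rist m v := by
  refine le_trans (rigidStab_mono ?_)
    (le_iSup₂_of_le (f := fun (w : List Bool) (_ : w.length = m) => rigidStab (cylinder (v ++ w)))
      (w.take m) (by simpa using h) le_rfl)
  conv_lhs => rw [← List.take_append_drop m w, ← List.append_assoc]
  exact cylinder_append_subset _ _

theorem rist_append_le {m n : ℕ} {v w : List Bool} (h : m ≤ w.length + n) :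
    rist n (v ++ w) ≤ rist m v := by
  refine iSup₂_le fun u hu => ?_
  rw [List.append_assoc]
  exact rigidStab_le_rist (by simp [hu, h])

theorem rist_anti {m n : ℕ} (h : m ≤ n) (v : List Bool) : rist n v ≤ rist m v := by
  have := rist_append_le (m := m) (n := n) (v := v) (w := []) (by simpa using h)
  rwa [List.append_nil] at this

theorem rist_le_rigidStab (m : ℕ) (v : List Bool) : rist m v ≤ rigidStab (cylinder v) :=
  iSup₂_le fun _ _ => rigidStab_mono (cylinder_append_subset _ _)

theorem disjoint_cylinder_children (v : List Bool) :
    Disjoint (cylinder (v ++ [false])) (cylinder (v ++ [true])) := by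
  rw [Set.disjoint_left]
  intro x h h'
  have h1 := h v.length (by simp)
  have h2 := h' v.length (by simp)
  simp at h1 h2
  simp [h1] at h2

/-- When A and B commute, elements of the join are products ab, and [ab, a'b'] = [a, a'][b, b']. -/
theorem commutator_sup_le_of_commute {G : Type*} [Group G] {A B : Subgroup G}
    (h : ∀ a ∈ A, ∀ b ∈ B, Commute a b) : ⁅A ⊔ B, A ⊔ B⁆ ≤ ⁅A, A⁆ ⊔ ⁅B, B⁆ := by
  have hmem : ∀ x ∈ A ⊔ B, ∃ a ∈ A, ∃ b ∈ B, x = a * b := by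
    intro x hx
    have h1 := MonoidHom.noncommCoprod_range A.subtype B.subtype fun a b => h a a.2 b b.2
    rw [Subgroup.range_subtype, Subgroup.range_subtype] at h1
    rw [← h1] at hx
    obtain ⟨⟨a, b⟩, rfl⟩ := hx
    exact ⟨a, a.2, b, b.2, rfl⟩
  rw [Subgroup.commutator_le]
  intro x hx y hy
  obtain ⟨a, ha, b, hb, rfl⟩ := hmem x hx
  obtain ⟨a', ha', b', hb', rfl⟩ := hmem y hy
  have e : ⁅a * b, a' * b'⁆ = ⁅a, a'⁆ * ⁅b, b'⁆ := by
    have h1 := (h a' ha' b hb).eq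
    have h2 := (h _ (inv_mem ha) b hb).eq
    have h3 := (h _ (inv_mem ha) b' hb').eq
    have h4 := (h _ (inv_mem ha) _ (inv_mem hb)).eq
    have h5 := (h _ (inv_mem ha') b hb).eq
    have h6 := (h _ (inv_mem ha') b' hb').eq
    have h7 := (h _ (inv_mem ha') _ (inv_mem hb)).eq
    have h8 := (h _ (inv_mem ha') _ (inv_mem hb')).eq
    simp only [commutatorElement_def, mul_inv_rev]
    calc a * b * (a' * b') * (b⁻¹ * a⁻¹) * (b'⁻¹ * a'⁻¹)
        = a * (b * a') * b' * (b⁻¹ * a⁻¹) * (b'⁻¹ * a'⁻¹) := by group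
      _ = a * a' * b * b' * (a⁻¹ * b⁻¹) * (a'⁻¹ * b'⁻¹) := by rw [← h1, h4, h8]; group
      _ = a * a' * (b * (b' * a⁻¹)) * b⁻¹ * (a'⁻¹ * b'⁻¹) := by group
      _ = a * a' * (b * a⁻¹) * b' * b⁻¹ * a'⁻¹ * b'⁻¹ := by rw [← h3]; group
      _ = a * a' * a⁻¹ * b * b' * (b⁻¹ * a'⁻¹) * b'⁻¹ := by rw [← h2]; group
      _ = a * a' * a⁻¹ * b * (b' * a'⁻¹) * b⁻¹ * b'⁻¹ := by rw [← h7]; group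
      _ = a * a' * a⁻¹ * (b * a'⁻¹) * b' * b⁻¹ * b'⁻¹ := by rw [← h6]; group
      _ = _ := by rw [← h5]; group
  rw [e]
  exact mul_mem (Subgroup.mem_sup_left (Subgroup.commutator_mem_commutator ha ha'))
    (Subgroup.mem_sup_right (Subgroup.commutator_mem_commutator hb hb'))

theorem rist_succ_le (m : ℕ) (v : List Bool) :
    rist (m + 1) v ≤ rist m (v ++ [false]) ⊔ rist m (v ++ [true]) := by
  refine iSup₂_le fun w hw => ?_
  obtain ⟨i, u, rfl⟩ : ∃ i u, w = i :: u := List.exists_cons_of_length_eq_add_one hw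
  have hu : m ≤ u.length := by simpa using hw.ge
  rw [← List.singleton_append, ← List.append_assoc]
  cases i
  · exact (rigidStab_le_rist hu).trans le_sup_left
  · exact (rigidStab_le_rist hu).trans le_sup_right

theorem commutator_rist_le_of_children {H : Subgroup grigorchuk} {v : List Bool}
    (h : ∀ i, ∃ m, ⁅rist m (v ++ [i]), rist m (v ++ [i])⁆ ≤ H) :
    ∃ m, ⁅rist m v, rist m v⁆ ≤ H := by
  obtain ⟨m₀, h₀⟩ := h false
  obtain ⟨m₁, h₁⟩ := h true
  refine ⟨max m₀ m₁ + 1, ?_⟩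
  refine (Subgroup.commutator_mono (rist_succ_le _ _) (rist_succ_le _ _)).trans ?_
  refine (commutator_sup_le_of_commute fun a ha b hb => commute_of_mem_rigidStab
    (disjoint_cylinder_children v) (rist_le_rigidStab _ _ ha) (rist_le_rigidStab _ _ hb)).trans ?_
  refine sup_le (le_trans ?_ h₀) (le_trans ?_ h₁)
  · exact Subgroup.commutator_mono (rist_anti (le_max_left _ _) _) (rist_anti (le_max_left _ _) _)
  · exact Subgroup.commutator_mono (rist_anti (le_max_right _ _) _) (rist_anti (le_max_right _ _) _)

-- Rigid stabilizers in the congruence topology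

theorem graft_mem_fixLevel (v : List Bool) (k : Equiv.Perm Ray) :
    graft v k ∈ fixLevel v.length := by
  induction v with
  | nil => exact fun x => funext fun i => i.elim0
  | cons i v ih =>
    rw [graft_cons]
    cases i
    · exact node_mem_fixLevel.2 ⟨ih, one_mem _⟩
    · exact node_mem_fixLevel.2 ⟨one_mem _, ih⟩

/-- The copy of `K` at a vertex. -/
def graftHom (v : List Bool) : kInG →* grigorchuk where
  toFun k := ⟨graft v k, gNormal_branchK.le (graft_mem_branchK v k.2)⟩
  map_one' := Subtype.ext (map_one (graft v))
  map_mul' _ _ := Subtype.ext (map_mul (graft v) _ _)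

theorem graftHom_mem_rigidStab (v : List Bool) (k : kInG) :
    graftHom v k ∈ rigidStab (cylinder v) :=
  mem_rigidStab.2 fun _ hx => graft_apply_of_notMem _ hx

instance : kInG.FiniteIndex := by
  refine Subgroup.finiteIndex_of_le (H := levelStab 4) fun g hg => ?_
  exact inf_fixLevel_four_le ⟨g.2, mem_levelStab.1 hg⟩

/-- A finite index subgroup of a rigid stabilizer of a vertex contains a deeper level rigid
stabilizer. -/
theorem exists_rist_le {v : List Bool} {Q : Subgroup grigorchuk}
    (hQ : Q.relIndex (rigidStab (cylinder v)) ≠ 0) : ∃ m, rist m v ≤ Q := by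
  have h1 : (Q.comap (graftHom v)).index ≠ 0 := by
    rw [Subgroup.index_comap]
    refine fun h => hQ (Subgroup.relIndex_eq_zero_of_le_right ?_ h)
    rintro _ ⟨k, rfl⟩
    exact graftHom_mem_rigidStab v k
  have h2 : ((Q.comap (graftHom v)).map kInG.subtype).FiniteIndex := by
    refine ⟨?_⟩
    rw [Subgroup.index_map_subtype]
    exact mul_ne_zero h1 Subgroup.FiniteIndex.index_ne_zero
  -- Pulled back along the copy of K at v, Q has finite index in K, hence in G, so it contains some
  -- St(m). An element supported m levels below v is the copy at v of an element of St(m).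
  obtain ⟨m, hm⟩ := exists_levelStab_le ((Q.comap (graftHom v)).map kInG.subtype)
  refine ⟨m, iSup₂_le fun w hw g hg => ?_⟩
  have hg' := mem_rigidStab.1 hg
  obtain ⟨k, hk, e⟩ := exists_graft g.2 hg'
  obtain ⟨h, hh, e'⟩ := exists_graft (v := v) g.2 fun x hx =>
    hg' x fun hx' => hx (cylinder_append_subset _ _ hx')
  have e2 : h = graft w k := by
    apply graft_injective v
    rw [← e', e, graft_append]
  obtain ⟨s, hs, e3⟩ := hm (x := ⟨h, hh⟩)
    (mem_levelStab.2 (by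
      show h ∈ fixLevel m
      rw [← hw, e2]; exact graft_mem_fixLevel w k))
  have e4 : graftHom v s = g := by
    apply Subtype.ext
    rw [e']
    exact congrArg (graft v) (congrArg Subtype.val e3)
  rw [← e4]
  exact hs

theorem graft_elemX_apply_ne {v : List Bool} {x : Ray} (hx : x ∈ cylinder v) :
    graft v elemX x ≠ x := by
  induction v generalizing x with
  | nil => exact elemX_apply_ne x
  | cons i v ih =>
    intro h
    have h' := congrArg tail h
    rw [graft_cons, tail_nodeAt, if_pos (mem_cylinder_cons.1 hx).1] at h'
    exact ih (mem_cylinder_cons.1 hx).2 h'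

theorem mem_cylinder_take {v : List Bool} {x : Ray} (hx : x ∈ cylinder v) (n : ℕ) :
    x ∈ cylinder (v.take n) := by
  have := cylinder_append_subset (v.take n) (v.drop n)
  rw [List.take_append_drop] at this
  exact this hx

theorem exists_mem_rist_smul_ne (m : ℕ) {v : List Bool} {x : Ray} (hx : x ∈ cylinder v) :
    ∃ g ∈ rist m v, g • x ≠ x := by
  set u := vertex (v.length + m) x
  have hu : x ∈ cylinder u := self_mem_cylinder_vertex _ _
  have e : u = v ++ u.drop v.length := by
    conv_lhs => rw [← List.take_append_drop v.length u]
    congr 1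
    have h1 := cylinder_eq_of_mem (mem_cylinder_take hu v.length)
    rw [h1, cylinder_eq_of_mem hx]
    simp [u]
  refine ⟨graftHom u ⟨⟨elemX, elemX_mem_grigorchuk⟩, elemX_mem⟩, ?_, graft_elemX_apply_ne hu⟩
  refine rigidStab_le_rist (w := u.drop v.length) (by simp [u]) ?_
  rw [← e]
  exact graftHom_mem_rigidStab _ _

/-! ### Elements of deep level stabilizers -/

/-- An element of St(j + N) is the product of the copies of its sections at level N, and these
sections lie in St(j). The agreement with g on the cylinder lets the user see which sections are
trivial. -/
theorem mem_of_forall_graft_mem {j N : ℕ} {g : Equiv.Perm Ray} (hg : g ∈ grigorchuk)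
    (hg' : g ∈ fixLevel (j + N)) {P : Subgroup (Equiv.Perm Ray)}
    (h : ∀ w : List Bool, w.length = N → ∀ k ∈ grigorchuk ⊓ fixLevel j,
      (∀ x ∈ cylinder w, g x = graft w k x) → graft w k ∈ P) : g ∈ P := by
  induction N generalizing g P with
  | zero => exact h [] rfl g ⟨hg, hg'⟩ fun _ _ => rfl
  | succ N ih =>
    obtain ⟨g₀, h₀, g₁, h₁, f₀, f₁, rfl⟩ := exists_node_of_mem_fixLevel (n := j + N) hg hg'
    have key : ∀ i, (if i then g₁ else g₀) ∈ P.comap (nodeAt i) := by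
      intro i
      refine ih (by cases i <;> assumption) (by cases i <;> assumption) fun w hw k hk hgk => ?_
      refine h (i :: w) (by simp [hw]) k hk fun x hx => ?_
      obtain ⟨hx0, hxt⟩ := mem_cylinder_cons.1 hx
      refine ray_ext ?_ ?_
      · rw [graft_cons, nodeAt_apply_zero, node_apply_zero]
      · rw [graft_cons, tail_nodeAt, if_pos hx0, ← hgk _ hxt, tail_node, hx0]
        cases i <;> simp
    have e : node g₀ g₁ = nodeAt false g₀ * nodeAt true g₁ := by simp [nodeAt, node_mul]
    rw [e]
    exact mul_mem (key false) (key true)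

theorem exists_pre_nhds {U : Set Ray} (hU : IsOpen U) {x : Ray} (hx : x ∈ U) :
    ∃ n, ∀ y, pre n y = pre n x → y ∈ U := by
  obtain ⟨I, u, hu, hsub⟩ := isOpen_pi_iff.1 hU x hx
  refine ⟨I.sup id + 1, fun y hy => hsub fun i hi => ?_⟩
  rw [pre_eq_iff.1 hy i (Nat.lt_succ_of_le (Finset.le_sup (f := id) hi))]
  exact (hu i hi).2

theorem exists_pre_invariant {C : Set Ray} (hC : IsClopen C) :
    ∃ n, ∀ x y, pre n x = pre n y → (x ∈ C ↔ y ∈ C) := by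
  have hloc : ∀ x : Ray, ∃ n, ∀ y, pre n y = pre n x → (y ∈ C ↔ x ∈ C) := by
    intro x
    by_cases hx : x ∈ C
    · obtain ⟨n, hn⟩ := exists_pre_nhds hC.isOpen hx
      exact ⟨n, fun y hy => iff_of_true (hn y hy) hx⟩
    · obtain ⟨n, hn⟩ := exists_pre_nhds hC.compl.isOpen hx
      exact ⟨n, fun y hy => iff_of_false (hn y hy) hx⟩
  choose f hf using hloc
  have hop : ∀ n x, IsOpen {y : Ray | pre n y = pre n x} := by
    intro n x
    have : Continuous (pre n) := continuous_pi fun i => continuous_apply _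
    exact (isOpen_discrete {pre n x}).preimage this
  obtain ⟨t, ht⟩ := isCompact_univ.elim_finite_subcover
    (fun x => {y : Ray | pre (f x) y = pre (f x) x})
    (fun x => hop _ _) fun x _ => Set.mem_iUnion.2 ⟨x, rfl⟩
  refine ⟨t.sup f, fun x y hxy => ?_⟩
  obtain ⟨z, hz, hxz⟩ := Set.mem_iUnion₂.1 (ht (Set.mem_univ x))
  have hyz : pre (f z) y = pre (f z) z := by
    rw [← hxz, pre_eq_iff]
    exact fun i hi => (pre_eq_iff.1 hxy i (hi.trans_le (Finset.le_sup hz))).symm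
  rw [hf z x hxz, hf z y hyz]

theorem exists_take_mem_index {C : Set Ray} {w : List Bool} (h : cylinder w ∩ C = ∅) :
    ∃ i ≤ w.length, w.take i ∈ index C ∧ ∀ j, cylinder (w.take j) ∩ C = ∅ → i ≤ j := by
  classical
  have hex : ∃ i, cylinder (w.take i) ∩ C = ∅ := ⟨w.length, by rwa [List.take_length]⟩
  have hle : Nat.find hex ≤ w.length := Nat.find_min' hex (by rwa [List.take_length])
  refine ⟨Nat.find hex, hle, ⟨Nat.find_spec hex, fun hne => ?_⟩, fun j hj => Nat.find_min' hex hj⟩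
  have hpos : 0 < Nat.find hex := by
    rw [Nat.pos_iff_ne_zero]
    intro h0
    rw [h0] at hne
    exact hne rfl
  have := Nat.find_min hex (m := Nat.find hex - 1) (by omega)
  rw [← ne_eq, ← Set.nonempty_iff_ne_empty] at this
  have e : (w.take (Nat.find hex)).dropLast = w.take (Nat.find hex - 1) := by
    rw [List.dropLast_eq_take, List.take_take, List.length_take, min_eq_left hle,
      min_eq_left (by omega)]
  rwa [e]

theorem graft_mem_commutator_rist {m : ℕ} {v w : List Bool} (h : m ≤ w.length)
    {k : Equiv.Perm Ray} (hk : k ∈ ⁅branchK, branchK⁆) :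
    graft (v ++ w) k ∈ ⁅rist m v, rist m v⁆.map grigorchuk.subtype := by
  have : ⁅branchK, branchK⁆ ≤
      (⁅rist m v, rist m v⁆.map grigorchuk.subtype).comap (graft (v ++ w)) := by
    rw [Subgroup.commutator_le]
    intro k hk l hl
    have hmem : ∀ (k : Equiv.Perm Ray) (hk : k ∈ branchK),
        graftHom (v ++ w) ⟨⟨k, gNormal_branchK.le hk⟩, hk⟩ ∈ rist m v := fun k hk =>
      rigidStab_le_rist h (graftHom_mem_rigidStab _ _)
    refine ⟨_, Subgroup.commutator_mem_commutator (hmem k hk) (hmem l hl), ?_⟩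
    rw [map_commutatorElement, map_commutatorElement]
    rfl
  exact this hk

/-- For clopen `C`, the direct sum of the derived rigid stabilizers is open in the pointwise
stabilizer of `C` for the congruence topology. -/
theorem exists_levelStab_inf_le_derivedSum {C : Set Ray} (hC : IsClopen C) (m : ℕ → ℕ) :
    ∃ M, levelStab M ⊓ fixingSubgroup grigorchuk C ≤ derivedSum m C := by
  obtain ⟨n, hn⟩ := exists_pre_invariant hC
  -- C is a union of cylinders of level n, so the vertices of I_C used below have level i ≤ n; level
  -- N is at least m i levels below each of them.
  set N := n + (Finset.range (n + 1)).sup m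
  have hN : ∀ i ≤ n, i + m i ≤ N := fun i hi =>
    Nat.add_le_add hi (Finset.le_sup (f := m) (Finset.mem_range.2 (by omega)))
  refine ⟨8 + N, fun g hg => ?_⟩
  have hfix : ∀ x ∈ C, g • x = x := fun x hx =>
    (mem_fixingSubgroup_iff grigorchuk).1 hg.2 x hx
  suffices hs : (g : Equiv.Perm Ray) ∈ (derivedSum m C).map grigorchuk.subtype from
    (Subgroup.mem_map_iff_mem grigorchuk.subtype_injective).1 hs
  refine mem_of_forall_graft_mem g.2 (mem_levelStab.1 hg.1) fun w hw k hk hgk => ?_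
  have hnN : n ≤ N := Nat.le_add_right _ _
  have hinv : ∀ x ∈ cylinder (w.take n), ∀ y ∈ cylinder (w.take n), x ∈ C → y ∈ C := by
    intro x hx y hy hxC
    refine (hn x y ?_).1 hxC
    have hl : (w.take n).length = n := by simp [hw, hnN]
    rw [cylinder_eq_of_mem hx, hl] at hy
    exact (mem_cylinder_vertex.1 hy).symm
  -- Off C, the section lies in St(8) ≤ K' and its vertex w is below a vertex of I_C. Otherwise the
  -- cylinder of w is inside C and the section is trivial.
  by_cases hwC : cylinder (w.take n) ∩ C = ∅
  · obtain ⟨i, hi, hidx, hmin⟩ := exists_take_mem_index (w := w) (C := C) (by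
      refine Set.subset_empty_iff.1 fun x hx => ?_
      rw [← hwC]
      exact ⟨mem_cylinder_take hx.1 n, hx.2⟩)
    have hin := hmin n hwC
    have hlen : (w.take i).length = i := by simp [hi]
    refine Subgroup.map_mono (f := grigorchuk.subtype)
      (le_iSup₂_of_le (w.take i) hidx le_rfl : _ ≤ derivedSum m C) ?_
    rw [hlen]
    have hle : m i ≤ (w.drop i).length := by
      have := hN i hin
      simp only [List.length_drop, hw]
      omega
    have := graft_mem_commutator_rist (v := w.take i) hle (inf_fixLevel_eight_le hk)
    rwa [List.take_append_drop] at this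
  · obtain ⟨y, hy, hyC⟩ := Set.nonempty_iff_ne_empty.2 hwC
    have : graft w k = 1 := by
      ext1 x
      by_cases hx : x ∈ cylinder w
      · rw [← hgk x hx]
        exact hfix x (hinv y hy x (mem_cylinder_take hx n) hyC)
      · exact graft_apply_of_notMem k hx
    rw [this]
    exact one_mem _

/-! ### Minimality -/

theorem exists_pre_smul_eq (n : ℕ) (x y : Ray) : ∃ g : grigorchuk, pre n (g • x) = pre n y := by
  suffices h : ∃ g ∈ grigorchuk, pre n (g x) = pre n y by
    obtain ⟨g, hg, e⟩ := h
    exact ⟨⟨g, hg⟩, e⟩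
  induction n generalizing x y with
  | zero => exact ⟨1, one_mem _, funext fun i => i.elim0⟩
  | succ n ih =>
    have key : ∀ x y : Ray, x 0 = y 0 → ∃ g ∈ grigorchuk, pre (n + 1) (g x) = pre (n + 1) y := by
      intro x y h0
      obtain ⟨g, hg, e⟩ := ih (tail x) (tail y)
      obtain ⟨h, hh, hgh⟩ := exists_node_left hg
      cases hx : x 0
      · refine ⟨_, hgh, pre_succ_eq_iff.2 ⟨h0, ?_⟩⟩
        rw [tail_node, hx]
        exact e
      · refine ⟨_, node_swap_mem hgh, pre_succ_eq_iff.2 ⟨h0, ?_⟩⟩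
        rw [tail_node, hx]
        exact e
    by_cases h0 : x 0 = y 0
    · exact key x y h0
    · obtain ⟨g, hg, e⟩ := key (genA x) y (by
        rw [genA_apply_zero]
        cases hx : x 0 <;> cases hy : y 0 <;> simp_all)
      exact ⟨g * genA, mul_mem hg genA_mem, e⟩

/-- A closed set that is invariant under the group is empty or everything. -/
theorem eq_univ_of_smul_mem {D : Set Ray} (hD : IsClosed D) (hne : D.Nonempty)
    (h : ∀ (g : grigorchuk), ∀ x ∈ D, g • x ∈ D) : D = Set.univ := by
  by_contra hD'
  obtain ⟨y, hy⟩ := (Set.ne_univ_iff_exists_notMem D).1 hD'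
  obtain ⟨x, hx⟩ := hne
  obtain ⟨n, hn⟩ := exists_pre_nhds hD.isOpen_compl hy
  obtain ⟨g, hg⟩ := exists_pre_smul_eq n x y
  exact hn _ hg (h g x hx)

/-- The action of an element of the group as a homeomorphism. -/
def smulHomeo (g : grigorchuk) : Ray ≃ₜ Ray where
  toEquiv := MulAction.toPerm g
  continuous_toFun := continuous_smul g
  continuous_invFun := continuous_smul g⁻¹

theorem interior_biUnion_eq_empty {X : Type*} [TopologicalSpace X] {S : Set (Set X)} (hS : S.Finite)
    (hc : ∀ E ∈ S, IsClosed E) (hi : ∀ E ∈ S, interior E = ∅) : interior (⋃₀ S) = ∅ := by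
  induction S, hS using Set.Finite.induction_on with
  | empty => simp
  | insert _ _ ih =>
    rw [Set.sUnion_insert, interior_union_isClosed_of_interior_empty (hc _ (Set.mem_insert _ _))]
    · exact hi _ (Set.mem_insert _ _)
    · exact ih (fun E hE => hc E (Set.mem_insert_of_mem _ hE))
        fun E hE => hi E (Set.mem_insert_of_mem _ hE)

/-- A closed set with finitely many translates is clopen. -/
theorem isClopen_of_finite_translates {C : Set Ray} (hC : IsClosed C)
    (hfin : (Set.range fun g : grigorchuk => smulHomeo g '' C).Finite) : IsClopen C := by
  rw [isClopen_iff_frontier_eq_empty]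
  by_contra hne
  set S : Set (Set Ray) := frontier '' (Set.range fun g : grigorchuk => smulHomeo g '' C)
  have hclosed : ∀ E ∈ Set.range (fun g : grigorchuk => smulHomeo g '' C), IsClosed E := by
    rintro _ ⟨g, rfl⟩
    exact (smulHomeo g).isClosedMap _ hC
  have hSfin : S.Finite := hfin.image _
  have hSc : ∀ E ∈ S, IsClosed E := by
    rintro _ ⟨E, -, rfl⟩
    exact isClosed_frontier
  have hSi : interior (⋃₀ S) = ∅ := by
    refine interior_biUnion_eq_empty hSfin hSc ?_
    rintro _ ⟨E, hE, rfl⟩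
    exact interior_frontier (hclosed E hE)
  have hS : S = Set.range fun g : grigorchuk => smulHomeo g '' frontier C := by
    show frontier '' _ = _
    rw [← Set.range_comp]
    congr 1
    funext g
    exact ((smulHomeo g).image_frontier C).symm
  -- The union of the frontiers of the translates is closed and invariant. If non-empty it is
  -- everything by minimality, but a finite union of nowhere dense closed sets has empty interior.
  have huniv : ⋃₀ S = Set.univ := by
    refine eq_univ_of_smul_mem (by
      rw [Set.sUnion_eq_biUnion]
      exact hSfin.isClosed_biUnion hSc) ?_ ?_
    · obtain ⟨x, hx⟩ := Set.nonempty_iff_ne_empty.2 hne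
      rw [hS]
      exact ⟨_, _, ⟨1, rfl⟩, x, hx, rfl⟩
    · rw [hS]
      rintro g _ ⟨_, ⟨h, rfl⟩, x, hx, rfl⟩
      exact ⟨_, ⟨g * h, rfl⟩, x, hx, mul_smul g h x⟩
  rw [huniv, interior_univ] at hSi
  exact Set.univ_nonempty.ne_empty hSi

/-! ### Measurability in the space of subgroups -/

instance : Countable grigorchuk := by
  let T : Set (Equiv.Perm Ray) := {genA, genB, genC, genD}
  have h : (grigorchuk : Set (Equiv.Perm Ray)) ⊆
      Set.range fun l : List T => (l.map Subtype.val).prod := by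
    intro g hg
    have hg' : g ∈ (Subgroup.closure T).toSubmonoid := hg
    rw [Subgroup.closure_toSubmonoid] at hg'
    obtain ⟨l, hl, rfl⟩ := Submonoid.exists_list_of_mem_closure hg'
    have hl' : ∀ x ∈ l, x ∈ T := by
      intro x hx
      rcases hl x hx with h | h
      · exact h
      · simp only [Set.mem_inv, T, Set.mem_insert_iff, Set.mem_singleton_iff] at h
        rcases h with h | h | h | h <;> rw [inv_eq_iff_eq_inv] at h <;> rw [h]
        · rw [genA_inv]; exact .inl rfl
        · rw [genB_inv]; exact .inr (.inl rfl)
        · rw [genC_inv]; exact .inr (.inr (.inl rfl))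
        · rw [genD_inv]; exact .inr (.inr (.inr rfl))
    lift l to List T using hl'
    exact ⟨l, rfl⟩
  have hT : Countable T := (Set.toFinite T).countable.to_subtype
  exact ((Set.countable_range _).mono h).to_subtype

theorem isClopen_setOf_mem (g : grigorchuk) : IsClopen {H : Subgroup grigorchuk | g ∈ H} := by
  classical
  have h : Continuous fun (H : Subgroup grigorchuk) (g : grigorchuk) => decide (g ∈ H) :=
    continuous_induced_dom
  have := (isClopen_discrete {true}).preimage ((continuous_apply g).comp h)
  convert this using 1
  ext H
  simp

theorem measurableSet_setOf_mem (g : grigorchuk) :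
    MeasurableSet {H : Subgroup grigorchuk | g ∈ H} :=
  (isClopen_setOf_mem g).isOpen.measurableSet

theorem measurableSet_setOf_le (L : Subgroup grigorchuk) :
    MeasurableSet {H : Subgroup grigorchuk | L ≤ H} := by
  have : {H : Subgroup grigorchuk | L ≤ H} = ⋂ g ∈ L, {H | g ∈ H} := by
    ext H
    simp [SetLike.le_def]
  rw [this]
  exact MeasurableSet.biInter (Set.to_countable _) fun g _ => measurableSet_setOf_mem g

theorem mem_conj_smul {g h : grigorchuk} {H : Subgroup grigorchuk} :
    h ∈ ConjAct.toConjAct g • H ↔ g⁻¹ * h * g ∈ H := by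
  rw [Subgroup.mem_pointwise_smul_iff_inv_smul_mem, ConjAct.smul_def]
  simp

/-! ### Partial rigid stabilizers in a random subgroup -/

/-- The elements supported in `U` that agree on `U` with an element of `H` supported in `U ∪ V`. -/
def partner {U V : Set Ray} (hUV : Disjoint U V) (H : Subgroup grigorchuk) :
    Subgroup grigorchuk where
  carrier := {f | f ∈ rigidStab U ∧ ∃ f' ∈ rigidStab V, f * f' ∈ H}
  one_mem' := ⟨one_mem _, 1, one_mem _, by rw [mul_one]; exact one_mem _⟩
  mul_mem' := by
    rintro f g ⟨hf, f', hf', hff⟩ ⟨hg, g', hg', hgg⟩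
    refine ⟨mul_mem hf hg, f' * g', mul_mem hf' hg', ?_⟩
    have e : f * g * (f' * g') = f * f' * (g * g') := by
      rw [mul_assoc, ← mul_assoc g, (commute_of_mem_rigidStab hUV hg hf').eq]
      simp only [mul_assoc]
    rw [e]
    exact mul_mem hff hgg
  inv_mem' := by
    rintro f ⟨hf, f', hf', hff⟩
    refine ⟨inv_mem hf, f'⁻¹, inv_mem hf', ?_⟩
    rw [(commute_of_mem_rigidStab hUV (inv_mem hf) (inv_mem hf')).eq, ← mul_inv_rev]
    exact inv_mem hff

theorem mem_partner {U V : Set Ray} {hUV : Disjoint U V} {H : Subgroup grigorchuk}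
    {f : grigorchuk} : f ∈ partner hUV H ↔ f ∈ rigidStab U ∧ ∃ f' ∈ rigidStab V, f * f' ∈ H :=
  Iff.rfl

theorem measurableSet_setOf_mem_partner {U V : Set Ray} (hUV : Disjoint U V) (f : grigorchuk) :
    MeasurableSet {H | f ∈ partner hUV H} := by
  have : {H | f ∈ partner hUV H} =
      {H : Subgroup grigorchuk | f ∈ rigidStab U} ∩ ⋃ f' ∈ rigidStab V, {H | f * f' ∈ H} := by
    ext H
    simp [mem_partner]
  rw [this]
  exact (MeasurableSet.const _).inter
    (MeasurableSet.biUnion (Set.to_countable _) fun _ _ => measurableSet_setOf_mem _)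

theorem mem_partner_conj {U V : Set Ray} {hUV : Disjoint U V} {H : Subgroup grigorchuk}
    {f p : grigorchuk} (hf : f ∈ rigidStab U) :
    p ∈ partner hUV (ConjAct.toConjAct f⁻¹ • H) ↔ f * p * f⁻¹ ∈ partner hUV H := by
  have h1 : p ∈ rigidStab U ↔ f * p * f⁻¹ ∈ rigidStab U := by
    rw [Subgroup.mul_mem_cancel_right _ (inv_mem hf), Subgroup.mul_mem_cancel_left _ hf]
  simp only [mem_partner, mem_conj_smul, inv_inv]
  refine and_congr h1 (exists_congr fun f' => and_congr_right fun hf' => ?_)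
  have e : f * (p * f') * f⁻¹ = f * p * f⁻¹ * f' := by
    rw [mul_assoc _ f⁻¹, (commute_of_mem_rigidStab hUV (inv_mem hf) hf').eq]
    simp only [mul_assoc]
  rw [e]

theorem smul_mem_rigidStab {U : Set Ray} {f g : grigorchuk} (hf : f ∈ rigidStab U) :
    g * f * g⁻¹ ∈ rigidStab (g • U) := by
  refine mem_rigidStab.2 fun x hx => ?_
  rw [Set.mem_smul_set_iff_inv_smul_mem] at hx
  rw [mul_smul, mul_smul, mem_rigidStab.1 hf _ hx, smul_inv_smul]

/-- The quotient of the two conjugates of g in H is ff'⁻¹ times g(f⁻¹f')g⁻¹, and the second factor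
lives on gU. -/
theorem mul_inv_mem_partner {U : Set Ray} {g : grigorchuk} (hg : Disjoint U (g • U))
    {H : Subgroup grigorchuk} {f f' : grigorchuk} (hf : f ∈ rigidStab U) (hf' : f' ∈ rigidStab U)
    (h : f * g * f⁻¹ ∈ H) (h' : f' * g * f'⁻¹ ∈ H) : f * f'⁻¹ ∈ partner hg H := by
  refine ⟨mul_mem hf (inv_mem hf'), g * (f⁻¹ * f') * g⁻¹,
    smul_mem_rigidStab (mul_mem (inv_mem hf) hf'), ?_⟩
  have e : f * f'⁻¹ * (g * (f⁻¹ * f') * g⁻¹) = f * g * f⁻¹ * (f' * g * f'⁻¹)⁻¹ := by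
    rw [mul_assoc, (commute_of_mem_rigidStab hg (inv_mem hf')
      (smul_mem_rigidStab (mul_mem (inv_mem hf) hf'))).eq]
    group
  rw [e]
  exact mul_mem h (inv_mem h')

/-- For a random subgroup, the partial rigid stabilizer has finite index in the rigid stabilizer. -/
theorem ae_relIndex_partner_ne_zero (μ : Measure (Subgroup grigorchuk)) [IsProbabilityMeasure μ]
    [SMulInvariantMeasure (ConjAct grigorchuk) (Subgroup grigorchuk) μ] {U : Set Ray}
    {g : grigorchuk} (hg : Disjoint U (g • U)) :
    ∀ᵐ H ∂μ, g ∈ H → (partner hg H).relIndex (rigidStab U) ≠ 0 := by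
  obtain ⟨code, hcode⟩ := Countable.exists_injective_nat grigorchuk
  -- The event that g ∈ H and f is the representative of least code in its left coset of the partial
  -- rigid stabilizer. The number of f for which it occurs is the number of cosets.
  let s : rigidStab U → Set (Subgroup grigorchuk) := fun f =>
    {H | g ∈ H ∧ ∀ f' : rigidStab U, (f : grigorchuk)⁻¹ * f' ∈ partner hg H → code f ≤ code f'}
  have hs : ∀ f, MeasurableSet (s f) := by
    intro f
    have : s f = {H | g ∈ H} ∩ ⋂ f' : rigidStab U,
        ({H | (f : grigorchuk)⁻¹ * f' ∈ partner hg H}ᶜ ∪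
          {H : Subgroup grigorchuk | code f ≤ code f'}) := by
      ext H
      simp only [s, Set.mem_ofPred_eq, Set.mem_inter_iff, Set.mem_iInter, Set.mem_union,
        Set.mem_compl_iff, imp_iff_not_or]
    rw [this]
    exact (measurableSet_setOf_mem g).inter (MeasurableSet.iInter fun f' =>
      (measurableSet_setOf_mem_partner hg _).compl.union (MeasurableSet.const _))
  let t : rigidStab U → Set (Subgroup grigorchuk) := fun f =>
    (fun H => ConjAct.toConjAct (f : grigorchuk)⁻¹ • H) ⁻¹' s f
  have ht : ∀ f, MeasurableSet (t f) := by
    intro f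
    have : t f = {H | (f : grigorchuk) * g * (f : grigorchuk)⁻¹ ∈ H} ∩ ⋂ f' : rigidStab U,
        ({H | (f' : grigorchuk) * (f : grigorchuk)⁻¹ ∈ partner hg H}ᶜ ∪
          {H : Subgroup grigorchuk | code f ≤ code f'}) := by
      ext H
      simp only [t, s, Set.mem_preimage, Set.mem_ofPred_eq, Set.mem_inter_iff, Set.mem_iInter,
        Set.mem_union, Set.mem_compl_iff, imp_iff_not_or, mem_partner_conj f.2, mem_conj_smul,
        inv_inv, mul_inv_cancel_left]
    rw [this]
    exact (measurableSet_setOf_mem _).inter (MeasurableSet.iInter fun f' =>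
      (measurableSet_setOf_mem_partner hg _).compl.union (MeasurableSet.const _))
  have hμ : ∀ f, μ (t f) = μ (s f) := fun f =>
    SMulInvariantMeasure.measure_preimage_smul _ (hs f)
  -- After conjugation the event says that fgf⁻¹ ∈ H and f has least code in its right coset. Two
  -- such f lie in one coset by `mul_inv_mem_partner`, hence coincide.
  have hdisj : Pairwise (Function.onFun Disjoint t) := by
    intro f f' hne
    refine Set.disjoint_left.2 fun H h h' => hne ?_
    simp only [t, s, Set.mem_preimage, Set.mem_ofPred_eq, mem_partner_conj f.2,
      mem_partner_conj f'.2, mem_conj_smul, inv_inv, mul_inv_cancel_left] at h h'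
    have hp := mul_inv_mem_partner hg f.2 f'.2 h.1 h'.1
    have hp' := mul_inv_mem_partner hg f'.2 f.2 h'.1 h.1
    exact Subtype.ext (hcode (le_antisymm (h.2 f' hp') (h'.2 f hp)))
  have hsum : ∑' f, μ (s f) ≠ ⊤ := by
    simp_rw [← hμ]
    rw [← measure_iUnion hdisj ht]
    exact measure_ne_top _ _
  -- By Borel–Cantelli, H almost surely belongs to finitely many of the events, so there are
  -- finitely many cosets.
  filter_upwards [ae_finite_setOfPred_mem hsum] with H hfin hgH
  have hfin' : Finite {f | H ∈ s f} := hfin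
  have hsurj : Function.Surjective fun f : {f | H ∈ s f} =>
      (QuotientGroup.mk f.1 : rigidStab U ⧸ (partner hg H).subgroupOf (rigidStab U)) := by
    intro q
    let A : Set (rigidStab U) := {f | QuotientGroup.mk f = q}
    have hA : A.Nonempty := QuotientGroup.mk_surjective q
    obtain ⟨f, hfA, hmin⟩ :=
      exists_minimalFor_of_wellFoundedLT (· ∈ A) (fun f => code f) hA
    refine ⟨⟨f, hgH, fun f' hf' => ?_⟩, hfA⟩
    have hf'A : f' ∈ A := by
      have h1 : (QuotientGroup.mk f : rigidStab U ⧸ (partner hg H).subgroupOf (rigidStab U)) =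
          QuotientGroup.mk f' := QuotientGroup.eq.2 hf'
      exact h1.symm.trans hfA
    rcases le_total (code f) (code f') with h | h
    · exact h
    · exact hmin hf'A h
  have : Finite (rigidStab U ⧸ (partner hg H).subgroupOf (rigidStab U)) := .of_surjective _ hsurj
  exact (Subgroup.finiteIndex_of_finite_quotient
    (H := (partner hg H).subgroupOf (rigidStab U))).index_ne_zero

/-! ### The double commutator argument -/

/-- Choose pp' and qq' in H with p' on V and q' on W. As U, V, W are pairwise disjoint, p' and q'
disappear from the commutator, which equals [p, q]. -/
theorem commutator_partner_le {U V W : Set Ray} (hV : Disjoint U V) (hW : Disjoint U W)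
    (hVW : Disjoint V W) (H : Subgroup grigorchuk) {Q : Subgroup grigorchuk}
    (hQV : Q ≤ partner hV H) (hQW : Q ≤ partner hW H) : ⁅Q, Q⁆ ≤ H := by
  rw [Subgroup.commutator_le]
  intro p hp q hq
  obtain ⟨hpU, p', hp', hpH⟩ := hQV hp
  obtain ⟨hqU, q', hq', hqH⟩ := hQW hq
  have c1 := commute_of_mem_rigidStab hV hpU hp'
  have c2 := commute_of_mem_rigidStab hV hqU hp'
  have c3 := commute_of_mem_rigidStab hW hpU hq'
  have c4 := commute_of_mem_rigidStab hW hqU hq'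
  have c5 := commute_of_mem_rigidStab hVW hp' hq'
  have e : ⁅p * p', q * q'⁆ = ⁅p, q⁆ := by
    have e1 : ⁅p * p', q * q'⁆ = ⁅p, q * q'⁆ := by
      have := commutator_commutator_of_commute (u := p') (k := p⁻¹) (l := q * q')
        c1.symm.inv_right (c2.symm.mul_right c5)
      rwa [inv_inv, ← c1.eq] at this
    have e2 : ⁅q * q', p⁆ = ⁅q, p⁆ := by
      have := commutator_commutator_of_commute (u := q') (k := q⁻¹) (l := p)
        c4.symm.inv_right c3.symm
      rwa [inv_inv, ← c4.eq] at this
    rw [e1, ← commutatorElement_inv, e2, commutatorElement_inv]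
  rw [← e, commutatorElement_def]
  exact mul_mem (mul_mem (mul_mem hpH hqH) (inv_mem hpH)) (inv_mem hqH)

theorem exists_pre_ne {x y : Ray} (h : x ≠ y) : ∃ n, ∀ m, n ≤ m → pre m x ≠ pre m y := by
  obtain ⟨i, hi⟩ := Function.ne_iff.1 h
  exact ⟨i + 1, fun m hm e => hi (pre_eq_iff.1 e i (by omega))⟩

theorem disjoint_smul_cylinder {n : ℕ} {g h : grigorchuk} {x : Ray}
    (hn : pre n (g • x) ≠ pre n (h • x)) :
    Disjoint (g • cylinder (vertex n x)) (h • cylinder (vertex n x)) := by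
  rw [Set.disjoint_left]
  rintro _ ⟨y, hy, rfl⟩ ⟨z, hz, e⟩
  have h1 := pre_smul g (mem_cylinder_vertex.1 hy)
  have h2 := pre_smul h (mem_cylinder_vertex.1 hz)
  have e' : h • z = g • y := e
  rw [e'] at h2
  exact hn (h1.symm.trans h2)

/-- The conclusion of the double commutator argument for `H` at the vertex `v`. -/
def CommutatorBelow (H : Subgroup grigorchuk) (v : List Bool) : Prop :=
  ∃ m, ⁅rist m v, rist m v⁆ ≤ H

theorem CommutatorBelow.append {H : Subgroup grigorchuk} {v : List Bool}
    (h : CommutatorBelow H v) (w : List Bool) : CommutatorBelow H (v ++ w) := by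
  obtain ⟨m, hm⟩ := h
  refine ⟨m, le_trans (Subgroup.commutator_mono ?_ ?_) hm⟩ <;>
    exact rist_append_le (Nat.le_add_left _ _)

theorem CommutatorBelow.of_append {H : Subgroup grigorchuk} (d : ℕ) :
    ∀ v, (∀ w : List Bool, w.length = d → CommutatorBelow H (v ++ w)) → CommutatorBelow H v := by
  induction d with
  | zero => exact fun v h => by simpa using h [] rfl
  | succ d ih =>
    intro v h
    refine commutator_rist_le_of_children fun i => ih _ fun w hw => ?_
    rw [List.append_assoc]
    exact h _ (by simp [hw])

theorem exists_commutatorBelow_of_smul_ne {H : Subgroup grigorchuk}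
    (hH : ∀ (v : List Bool) (g : grigorchuk) (hg : Disjoint (cylinder v) (g • cylinder v)),
      g ∈ H → (partner hg H).relIndex (rigidStab (cylinder v)) ≠ 0)
    {x : Ray} {g : grigorchuk} (hg : g ∈ H) (hx : g • x ≠ x) :
    ∃ n, CommutatorBelow H (vertex n x) := by
  have hdis : ∀ {n : ℕ} {h : grigorchuk}, pre n x ≠ pre n (h • x) →
      Disjoint (cylinder (vertex n x)) (h • cylinder (vertex n x)) := by
    intro n h hn
    have := disjoint_smul_cylinder (g := 1) (h := h) (x := x) (n := n) (by rwa [one_smul])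
    rwa [one_smul] at this
  obtain ⟨n₀, hn₀⟩ := exists_pre_ne hx.symm
  have hd := hdis (hn₀ n₀ le_rfl)
  have hxU := self_mem_cylinder_vertex n₀ x
  obtain ⟨m, hm⟩ := exists_rist_le (hH _ g hd hg)
  -- The second element of H is ff': f' fixes x because it lives on gU, and f moves x within U. So
  -- its image of x differs from both x and gx.
  obtain ⟨f, hf, hfx⟩ := exists_mem_rist_smul_ne m hxU
  obtain ⟨hfU, f', hf', hff⟩ := hm hf
  have hf'x : f' • x = x := mem_rigidStab.1 hf' x (Set.disjoint_left.1 hd hxU)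
  have hhx : (f * f') • x = f • x := by rw [mul_smul, hf'x]
  have hfxU : f • x ∈ cylinder (vertex n₀ x) := by
    by_contra h
    exact hfx (smul_left_cancel f (mem_rigidStab.1 hfU _ h))
  have hgxU : g • x ∉ cylinder (vertex n₀ x) := fun h =>
    hn₀ n₀ le_rfl (mem_cylinder_vertex.1 h).symm
  obtain ⟨n₁, hn₁⟩ := exists_pre_ne (x := x) (y := (f * f') • x) (by rw [hhx]; exact hfx.symm)
  obtain ⟨n₂, hn₂⟩ := exists_pre_ne (x := g • x) (y := (f * f') • x) (by
    rw [hhx]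
    exact fun e => hgxU (e ▸ hfxU))
  set n := max n₀ (max n₁ n₂)
  have hdg := hdis (hn₀ n (by omega))
  have hdh := hdis (hn₁ n (by omega))
  have hgh := disjoint_smul_cylinder (hn₂ n (by omega))
  obtain ⟨m', hm'⟩ := exists_rist_le (v := vertex n x)
    (Subgroup.relIndex_inf_ne_zero (hH _ g hdg hg) (hH _ (f * f') hdh hff))
  exact ⟨n, m', commutator_partner_le hdg hdh hgh H (hm'.trans inf_le_left)
    (hm'.trans inf_le_right)⟩

theorem isClosed_cylinder (v : List Bool) : IsClosed (cylinder v) := by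
  have : cylinder v = ⋂ (i : ℕ) (h : i < v.length), {x : Ray | x i = v[i]} := by
    ext x; simp [cylinder]
  rw [this]
  exact isClosed_iInter fun i => isClosed_iInter fun h =>
    isClosed_eq (continuous_apply i) continuous_const

theorem isOpen_cylinder_vertex (n : ℕ) (x : Ray) : IsOpen (cylinder (vertex n x)) := by
  have : cylinder (vertex n x) = pre n ⁻¹' {pre n x} := by
    ext y; exact mem_cylinder_vertex
  rw [this]
  exact (isOpen_discrete _).preimage (continuous_pi fun i => continuous_apply _)

theorem mem_fix {H : Subgroup grigorchuk} {x : Ray} :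
    x ∈ (fix H : Set Ray) ↔ ∀ g ∈ H, g • x = x := by
  show x ∈ MulAction.fixedPoints H Ray ↔ _
  simp [MulAction.mem_fixedPoints, Subgroup.smul_def]

theorem commutatorBelow_of_disjoint_fix {H : Subgroup grigorchuk}
    (hH : ∀ (v : List Bool) (g : grigorchuk) (hg : Disjoint (cylinder v) (g • cylinder v)),
      g ∈ H → (partner hg H).relIndex (rigidStab (cylinder v)) ≠ 0)
    {v : List Bool} (hv : cylinder v ∩ fix H = ∅) : CommutatorBelow H v := by
  have hloc : ∀ x : Ray, ∃ n, x ∈ cylinder v → CommutatorBelow H (vertex n x) := by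
    intro x
    by_cases hx : x ∈ cylinder v
    · have : x ∉ (fix H : Set Ray) := fun h => by
        have : x ∈ cylinder v ∩ fix H := ⟨hx, h⟩
        rw [hv] at this
        exact this
      rw [mem_fix] at this
      push Not at this
      obtain ⟨g, hg, hgx⟩ := this
      obtain ⟨n, hn⟩ := exists_commutatorBelow_of_smul_ne hH hg hgx
      exact ⟨n, fun _ => hn⟩
    · exact ⟨0, fun h => absurd h hx⟩
  choose f hf using hloc
  obtain ⟨t, htv, ht⟩ := (isClosed_cylinder v).isCompact.elim_nhds_subcover
    (fun x => cylinder (vertex (f x) x)) fun x _ =>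
      (isOpen_cylinder_vertex _ _).mem_nhds (self_mem_cylinder_vertex _ _)
  -- At this depth below v, every vertex lies below a vertex of the finite subcover.
  refine CommutatorBelow.of_append (t.sup f) v fun w hw => ?_
  obtain ⟨y, hy⟩ := cylinder_nonempty (v ++ w)
  obtain ⟨z, hz, hyz⟩ := Set.mem_iUnion₂.1 (ht (cylinder_append_subset _ _ hy))
  have hle : f z ≤ (v ++ w).length := by
    have : f z ≤ t.sup f := Finset.le_sup hz
    simp only [List.length_append, hw]
    omega
  have e1 := cylinder_eq_of_mem hyz
  have e2 := cylinder_eq_of_mem (mem_cylinder_take hy (f z))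
  rw [length_vertex] at e1
  rw [List.length_take, min_eq_left hle, ← e1] at e2
  have := (hf z (htv z hz)).append ((v ++ w).drop (f z))
  rwa [← e2, List.take_append_drop] at this

theorem ae_commutatorBelow (μ : Measure (Subgroup grigorchuk)) [IsProbabilityMeasure μ]
    [SMulInvariantMeasure (ConjAct grigorchuk) (Subgroup grigorchuk) μ] :
    ∀ᵐ H ∂μ, ∀ v, cylinder v ∩ fix H = ∅ → CommutatorBelow H v := by
  have h : ∀ᵐ H ∂μ, ∀ (v : List Bool) (g : grigorchuk)
      (hg : Disjoint (cylinder v) (g • cylinder v)), g ∈ H →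
        (partner hg H).relIndex (rigidStab (cylinder v)) ≠ 0 := by
    refine ae_all_iff.2 fun v => ae_all_iff.2 fun g => ae_all_iff.2 fun hg => ?_
    exact ae_relIndex_partner_ne_zero μ hg
  filter_upwards [h] with H hH v hv
  exact commutatorBelow_of_disjoint_fix hH hv

/-! ### The space of closed subsets of the boundary -/

instance : MeasurableSpace (Compacts Ray) := borel _

instance : BorelSpace (Compacts Ray) := ⟨rfl⟩

/-- The vertices of level `n` below which there are points of `K`. -/
def trace (n : ℕ) (K : Set Ray) : Set (Fin n → Bool) := pre n '' K

theorem continuous_pre (n : ℕ) : Continuous (pre n) := continuous_pi fun _ => continuous_apply _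

theorem isClopen_pre_preimage (n : ℕ) (S : Set (Fin n → Bool)) : IsClopen (pre n ⁻¹' S) :=
  (isClopen_discrete S).preimage (continuous_pre n)

theorem mem_trace_iff {n : ℕ} {K : Set Ray} {w : Fin n → Bool} :
    w ∈ trace n K ↔ (K ∩ pre n ⁻¹' {w}).Nonempty := Iff.rfl

theorem trace_eq_of_le {m n : ℕ} (h : m ≤ n) {K L : Set Ray} (e : trace n K = trace n L) :
    trace m K = trace m L := by
  have key : ∀ K : Set Ray, trace m K = (fun w i => w (Fin.castLE h i)) '' trace n K := by
    intro K
    rw [trace, trace, Set.image_image]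
    rfl
  rw [key, key, e]

theorem measurableSet_setOf_trace_eq {Ω : Type*} [MeasurableSpace Ω] {f : Ω → Set Ray} {n : ℕ}
    (h : ∀ w, MeasurableSet {ω | w ∈ trace n (f ω)}) (S : Set (Fin n → Bool)) :
    MeasurableSet {ω | trace n (f ω) = S} := by
  have : {ω | trace n (f ω) = S} = ⋂ w, {ω | w ∈ trace n (f ω) ↔ w ∈ S} := by
    ext ω
    simp [Set.ext_iff]
  rw [this]
  refine MeasurableSet.iInter fun w => ?_
  by_cases hw : w ∈ S
  · simpa [hw] using h w
  · have e : {ω | w ∈ trace n (f ω) ↔ w ∈ S} = {ω | w ∈ trace n (f ω)}ᶜ := by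
      ext ω
      simp [hw]
    rw [e]
    exact (h w).compl

/-- The sets of closed sets with a given trace on a level. -/
def traceSets : Set (Set (Compacts Ray)) :=
  Set.range fun p : Σ n : ℕ, Set (Fin n → Bool) => {K : Compacts Ray | trace p.1 K = p.2}

theorem measurableSet_traceSet (n : ℕ) (S : Set (Fin n → Bool)) :
    MeasurableSet {K : Compacts Ray | trace n K = S} :=
  measurableSet_setOf_trace_eq (f := fun K : Compacts Ray => (K : Set Ray))
    (fun w => (Compacts.isOpen_inter_nonempty_of_isOpen
      (isClopen_pre_preimage n {w}).isOpen).measurableSet) S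

/-- The trace on a level determines those on the levels above, so two trace sets are nested or
disjoint. -/
theorem isPiSystem_traceSets : IsPiSystem traceSets := by
  have key : ∀ {m n : ℕ} (_ : m ≤ n) (S : Set (Fin m → Bool)) (T : Set (Fin n → Bool)),
      ({K : Compacts Ray | trace m K = S} ∩ {K | trace n K = T}).Nonempty →
      {K : Compacts Ray | trace m K = S} ∩ {K | trace n K = T} =
        {K : Compacts Ray | trace n K = T} := by
    rintro m n h S T ⟨K, hK, hK'⟩
    refine Set.inter_eq_right.2 fun L hL => ?_
    exact (trace_eq_of_le h (hL.trans hK'.symm)).trans hK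
  rintro _ ⟨⟨m, S⟩, rfl⟩ _ ⟨⟨n, T⟩, rfl⟩ hne
  rcases le_total m n with h | h
  · exact ⟨⟨n, T⟩, (key h S T hne).symm⟩
  · rw [Set.inter_comm] at hne ⊢
    exact ⟨⟨m, S⟩, (key h T S hne).symm⟩

theorem measurableSet_generateFrom_traceSets {B : Set (Compacts Ray)}
    (h : ∀ K ∈ B, ∃ n, ∀ L : Compacts Ray, trace n L = trace n K → L ∈ B) :
    MeasurableSet[MeasurableSpace.generateFrom traceSets] B := by
  have : B = ⋃ p ∈ {p : Σ n : ℕ, Set (Fin n → Bool) | {K : Compacts Ray | trace p.1 K = p.2} ⊆ B},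
      {K : Compacts Ray | trace p.1 K = p.2} := by
    refine Set.Subset.antisymm (fun K hK => ?_) (Set.iUnion₂_subset fun p hp => hp)
    obtain ⟨n, hn⟩ := h K hK
    exact Set.mem_iUnion₂.2 ⟨⟨n, trace n K⟩, fun L hL => hn L hL, rfl⟩
  rw [this]
  exact MeasurableSet.biUnion (Set.to_countable _) fun p _ =>
    MeasurableSpace.measurableSet_generateFrom ⟨p, rfl⟩

theorem exists_pre_subset {K U : Set Ray} (hK : IsCompact K) (hU : IsOpen U) (h : K ⊆ U) :
    ∃ n, pre n ⁻¹' trace n K ⊆ U := by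
  have hloc : ∀ x : Ray, ∃ n, x ∈ K → ∀ y, pre n y = pre n x → y ∈ U := by
    intro x
    by_cases hx : x ∈ K
    · obtain ⟨n, hn⟩ := exists_pre_nhds hU (h hx)
      exact ⟨n, fun _ => hn⟩
    · exact ⟨0, fun h => absurd h hx⟩
  choose f hf using hloc
  obtain ⟨t, htK, ht⟩ := hK.elim_nhds_subcover (fun x => cylinder (vertex (f x) x)) fun x _ =>
      (isOpen_cylinder_vertex _ _).mem_nhds (self_mem_cylinder_vertex _ _)
  refine ⟨t.sup f, ?_⟩
  rintro y ⟨x, hx, e⟩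
  obtain ⟨z, hz, hxz⟩ := Set.mem_iUnion₂.1 (ht hx)
  refine hf z (htK z hz) y ?_
  rw [← mem_cylinder_vertex.1 hxz, pre_eq_iff]
  exact fun i hi => (pre_eq_iff.1 e i (hi.trans_le (Finset.le_sup hz))).symm

/-- Membership of K in a subbasic Vietoris set (K inside U, or K meeting U) depends on a trace of K
on a sufficiently deep level, and there are countably many trace sets. -/
theorem borel_eq_generateFrom_traceSets :
    borel (Compacts Ray) = MeasurableSpace.generateFrom traceSets := by
  refine le_antisymm ?_ (MeasurableSpace.generateFrom_le ?_)
  · rw [borel_eq_generateFrom_of_subbasis (t := Compacts.topology)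
      (induced_generateFrom_eq (f := ((↑) : Compacts Ray → Set Ray)))]
    refine MeasurableSpace.generateFrom_le ?_
    rintro _ ⟨_, ⟨U, hU, rfl⟩ | ⟨U, hU, rfl⟩, rfl⟩
    · refine measurableSet_generateFrom_traceSets fun K hK => ?_
      obtain ⟨n, hn⟩ := exists_pre_subset K.isCompact hU hK
      refine ⟨n, fun L hL x hx => hn ?_⟩
      rw [← hL]
      exact ⟨x, hx, rfl⟩
    · refine measurableSet_generateFrom_traceSets ?_
      rintro K ⟨x, hxK, hxU⟩
      obtain ⟨n, hn⟩ := exists_pre_nhds hU hxU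
      refine ⟨n, fun L hL => ?_⟩
      have : pre n x ∈ trace n L := by rw [hL]; exact ⟨x, hxK, rfl⟩
      obtain ⟨y, hyL, hy⟩ := this
      exact ⟨y, hyL, hn y hy⟩
  · rintro _ ⟨p, rfl⟩
    exact measurableSet_traceSet p.1 p.2

theorem measurable_compacts {Ω : Type*} [MeasurableSpace Ω] {f : Ω → Compacts Ray}
    (h : ∀ n S, MeasurableSet {ω | trace n (f ω) = S}) : Measurable f := by
  have key : @Measurable _ _ _ (MeasurableSpace.generateFrom traceSets) f := by
    refine measurable_generateFrom ?_
    rintro _ ⟨p, rfl⟩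
    exact h p.1 p.2
  rwa [← borel_eq_generateFrom_traceSets] at key

theorem isClopen_iff_exists_trace {C : Set Ray} :
    IsClopen C ↔ ∃ (n : ℕ) (S : Set (Fin n → Bool)), C = pre n ⁻¹' S := by
  constructor
  · intro h
    obtain ⟨n, hn⟩ := exists_pre_invariant h
    refine ⟨n, trace n C, Set.Subset.antisymm (Set.subset_preimage_image _ _) ?_⟩
    rintro y ⟨x, hx, e⟩
    exact (hn x y e).1 hx
  · rintro ⟨n, S, rfl⟩
    exact isClopen_pre_preimage n S

theorem eq_of_forall_trace_eq {C D : Set Ray} (hC : IsClosed C) (hD : IsClosed D)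
    (h : ∀ n, trace n C = trace n D) : C = D := by
  have key : ∀ {C D : Set Ray}, IsClosed D → (∀ n, trace n C = trace n D) → C ⊆ D := by
    intro C D hD h x hx
    by_contra hxD
    obtain ⟨n, hn⟩ := exists_pre_nhds hD.isOpen_compl hxD
    have : pre n x ∈ trace n D := by rw [← h]; exact ⟨x, hx, rfl⟩
    obtain ⟨y, hy, e⟩ := this
    exact hn y e hy
  exact (key hD h).antisymm (key hC fun n => (h n).symm)

/-! ### Measurability and equivariance of the fixed point set -/

/-- By compactness, Fix(H) misses A exactly when finitely many elements of H have no common fixed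
point in A; there are countably many finite sets to consider. -/
theorem measurableSet_disjoint_fix {A : Set Ray} (hA : IsClosed A) :
    MeasurableSet {H : Subgroup grigorchuk | A ∩ fix H = ∅} := by
  have hfixed : ∀ g : grigorchuk, IsClosed {x : Ray | g • x = x} := fun g =>
    isClosed_eq (continuous_smul g) continuous_id
  have : {H : Subgroup grigorchuk | A ∩ fix H = ∅} =
      ⋃ F ∈ {F : Finset grigorchuk | A ∩ ⋂ g ∈ F, {x : Ray | g • x = x} = ∅},
        ⋂ g ∈ F, {H | g ∈ H} := by
    ext H
    simp only [Set.mem_ofPred_eq, Set.mem_iUnion, Set.mem_iInter, exists_prop]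
    constructor
    · intro h
      obtain ⟨u, hu⟩ := hA.isCompact.elim_finite_subfamily_closed
        (fun g : H => {x : Ray | (g : grigorchuk) • x = x}) (fun g => hfixed g) (by
          rw [← h]
          congr 1
          ext x
          rw [mem_fix, Set.mem_iInter]
          exact ⟨fun h g hg => h ⟨g, hg⟩, fun h g => h g g.2⟩)
      refine ⟨u.map (Function.Embedding.subtype _), ?_, fun g hg => ?_⟩
      · rw [← hu]
        congr 1
        ext x
        simp
      · obtain ⟨g, -, rfl⟩ := Finset.mem_map.1 hg
        exact g.2
    · rintro ⟨F, hF, hFH⟩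
      refine Set.subset_empty_iff.1 fun x hx => ?_
      rw [← hF]
      exact ⟨hx.1, Set.mem_iInter₂.2 fun g hg => mem_fix.1 hx.2 g (hFH g hg)⟩
  rw [this]
  exact MeasurableSet.biUnion (Set.to_countable _) fun F _ =>
    MeasurableSet.biInter (Set.to_countable _) fun g _ => measurableSet_setOf_mem g

theorem measurableSet_trace_fix (n : ℕ) (S : Set (Fin n → Bool)) :
    MeasurableSet {H : Subgroup grigorchuk | trace n (fix H) = S} := by
  refine measurableSet_setOf_trace_eq (fun w => ?_) S
  have : {H : Subgroup grigorchuk | w ∈ trace n (fix H)} =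
      {H : Subgroup grigorchuk | pre n ⁻¹' {w} ∩ fix H = ∅}ᶜ := by
    ext H
    rw [Set.mem_compl_iff, Set.mem_ofPred_eq, Set.mem_ofPred_eq, mem_trace_iff, Set.inter_comm,
      Set.nonempty_iff_ne_empty]
  rw [this]
  exact (measurableSet_disjoint_fix (isClopen_pre_preimage n {w}).isClosed).compl

theorem measurable_fix : Measurable fix := measurable_compacts measurableSet_trace_fix

theorem fix_conj (g : grigorchuk) (H : Subgroup grigorchuk) :
    (fix (ConjAct.toConjAct g • H) : Set Ray) = smulHomeo g '' fix H := by
  ext x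
  have : x ∈ smulHomeo g '' fix H ↔ g⁻¹ • x ∈ (fix H : Set Ray) := by
    constructor
    · rintro ⟨y, hy, rfl⟩
      have : g⁻¹ • smulHomeo g y = y := inv_smul_smul g y
      rwa [this]
    · exact fun h => ⟨_, h, smul_inv_smul g x⟩
  rw [this, mem_fix, mem_fix]
  constructor
  · intro h k hk
    have := h (g * k * g⁻¹) (mem_conj_smul.2 (by simpa [mul_assoc] using hk))
    rw [mul_smul, mul_smul] at this
    rw [← inv_smul_smul g (k • g⁻¹ • x), this]
  · intro h k hk
    have := h _ (mem_conj_smul.1 hk)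
    rw [mul_smul, mul_smul, smul_inv_smul] at this
    exact smul_left_cancel _ this

theorem trace_image_smul (n : ℕ) (g : grigorchuk) (K : Set Ray) :
    trace n (smulHomeo g '' K) = levelHom n g • trace n K := by
  rw [trace, trace, Set.image_image]
  show _ = (fun w => levelHom n g • w) '' _
  rw [Set.image_image]
  exact Set.image_congr fun x _ => (levelHom_pre n g x).symm

theorem trace_fix_conj (n : ℕ) (g : grigorchuk) (H : Subgroup grigorchuk) :
    trace n (fix (ConjAct.toConjAct g • H)) = levelHom n g • trace n (fix H) := by
  rw [fix_conj, trace_image_smul]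

/-! ### Ergodicity and uniform laws on finite orbits -/

theorem ae_mem_of_invariant {μ : Measure (Subgroup grigorchuk)}
    [ErgodicSMul (ConjAct grigorchuk) (Subgroup grigorchuk) μ] {s : Set (Subgroup grigorchuk)}
    (hs : MeasurableSet s) (hinv : ∀ (g : grigorchuk), ∀ H ∈ s, ConjAct.toConjAct g • H ∈ s)
    (h0 : μ s ≠ 0) : ∀ᵐ H ∂μ, H ∈ s := by
  have h := ErgodicSMul.aeconst_of_forall_preimage_smul_ae_eq (G := ConjAct grigorchuk) (μ := μ) hs
    fun g => by
      have : (g • ·) ⁻¹' s = s := by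
        ext H
        refine ⟨fun h => ?_, fun h => hinv (ConjAct.ofConjAct g) H h⟩
        have := hinv (ConjAct.ofConjAct g⁻¹) _ h
        rwa [ConjAct.toConjAct_ofConjAct, inv_smul_smul] at this
      exact Filter.EventuallyEq.of_eq this
  rcases Filter.eventuallyConst_set.1 h with h | h
  · exact h
  · exact absurd (measure_eq_zero_iff_ae_notMem.2 h) h0

open Classical in
-- An invariant law carried by one finite orbit is uniform there. Applied both to traces of Fix(H)
-- and to traces of Haar translates, this identifies the two laws.
theorem measure_eq_of_invariant {Ω X Γ : Type*} [MeasurableSpace Ω] [Group Γ] [MulAction Γ X]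
    [Finite Γ] {P : Measure Ω} [IsProbabilityMeasure P] {f : Ω → X} {x₀ : X}
    (hf : ∀ x, MeasurableSet {ω | f ω = x})
    (hinv : ∀ (g : Γ) x, P {ω | f ω = g • x} = P {ω | f ω = x})
    (hae : ∀ᵐ ω ∂P, f ω ∈ MulAction.orbit Γ x₀) (x : X) :
    P {ω | f ω = x} =
      if x ∈ MulAction.orbit Γ x₀ then ((MulAction.orbit Γ x₀).ncard : ENNReal)⁻¹ else 0 := by
  have hfin : (MulAction.orbit Γ x₀).Finite := Set.finite_range _
  have hx₀ : P {ω | f ω = x₀} = ((MulAction.orbit Γ x₀).ncard : ENNReal)⁻¹ := by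
    have h1 : P (⋃ x ∈ hfin.toFinset, {ω | f ω = x}) = 1 := by
      rw [← measure_univ (μ := P)]
      refine measure_congr (Filter.eventuallyEq_univ.2 ?_)
      filter_upwards [hae] with ω hω
      exact Set.mem_iUnion₂.2 ⟨f ω, hfin.mem_toFinset.2 hω, rfl⟩
    rw [measure_biUnion_finset] at h1
    · rw [Finset.sum_congr rfl (g := fun _ => P {ω | f ω = x₀})] at h1
      · rw [Finset.sum_const, nsmul_eq_mul, ← Set.ncard_eq_toFinset_card _ hfin] at h1
        rw [mul_comm] at h1
        exact ENNReal.eq_inv_of_mul_eq_one_left h1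
      · intro y hy
        obtain ⟨g, rfl⟩ := hfin.mem_toFinset.1 hy
        exact hinv g x₀
    · intro y _ z _ hyz
      exact Set.disjoint_left.2 fun ω h h' => hyz (h.symm.trans h')
    · exact fun y _ => hf y
  split_ifs with hx
  · obtain ⟨g, rfl⟩ := hx
    exact (hinv g x₀).trans hx₀
  · refine measure_eq_zero_iff_ae_notMem.2 ?_
    filter_upwards [hae] with ω hω h
    exact hx (h ▸ hω)

/-! ### The action of the profinite completion -/

theorem completionLevel_mul (n : ℕ) (γ δ : Completion) :
    completionLevel n (γ * δ) = completionLevel n γ * completionLevel n δ :=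
  map_mul (QuotientGroup.kerLift (levelHom n)) _ _

/-- The image of an element of the group in the completion. -/
def eta (g : grigorchuk) : Completion :=
  ProfiniteGrp.ProfiniteCompletion.etaFn (GrpCat.of grigorchuk) g

theorem completionLevel_eta (n : ℕ) (g : grigorchuk) :
    completionLevel n (eta g) = levelHom n g := rfl

theorem levelStab_anti {m n : ℕ} (h : m ≤ n) : levelStab n ≤ levelStab m := fun _ hg =>
  mem_levelStab.2 (fixLevel_anti h (mem_levelStab.1 hg))

/-- Lift the coordinate of γ at St(n); compatibility of the coordinates handles the smaller levels.
Thus γ acts on finitely many levels like an element of the group. -/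
theorem exists_completionLevel_eq (γ : Completion) (n : ℕ) :
    ∃ g : grigorchuk, ∀ m ≤ n, completionLevel m γ = levelHom m g := by
  obtain ⟨g, hg⟩ := QuotientGroup.mk_surjective
    (γ.1 (FiniteIndexNormalSubgroup.ofSubgroup (levelStab n)))
  refine ⟨g, fun m hm => ?_⟩
  have hle : FiniteIndexNormalSubgroup.ofSubgroup (levelStab n) ≤
      FiniteIndexNormalSubgroup.ofSubgroup (levelStab m) := levelStab_anti hm
  have := γ.2 (CategoryTheory.homOfLE hle)
  rw [completionLevel, ← this, ← hg]
  rfl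

theorem pre_act (γ : Completion) (n : ℕ) (x : Ray) :
    pre n (act γ x) = completionLevel n γ (pre n x) := by
  obtain ⟨g, hg⟩ := exists_completionLevel_eq γ n
  rw [hg n le_rfl, levelHom_pre, pre_eq_iff]
  intro i hi
  show completionLevel (i + 1) γ (pre (i + 1) x) (Fin.last i) = _
  rw [hg (i + 1) hi, levelHom_pre]
  rfl

theorem trace_bdryTranslate (n : ℕ) (γ : Completion) (C : Compacts Ray) :
    trace n (bdryTranslate γ C) = completionLevel n γ • trace n C := by
  show pre n '' (act γ '' C) = (fun w => completionLevel n γ • w) '' (pre n '' C)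
  rw [Set.image_image, Set.image_image]
  exact Set.image_congr fun x _ => pre_act γ n x

theorem completionLevel_mem_range (n : ℕ) (γ : Completion) :
    completionLevel n γ ∈ (levelHom n).range := by
  obtain ⟨g, hg⟩ := exists_completionLevel_eq γ n
  exact ⟨g, (hg n le_rfl).symm⟩

theorem isOpen_completionLevel_eq (n : ℕ) (σ : Equiv.Perm (Fin n → Bool)) :
    IsOpen {γ : Completion | completionLevel n γ = σ} := by
  let N := FiniteIndexNormalSubgroup.ofSubgroup (levelStab n)
  let Q := (ProfiniteGrp.ProfiniteCompletion.diagram (GrpCat.of grigorchuk)).obj N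
  have hc : Continuous fun γ : Completion => (γ.1 N : Q) :=
    (continuous_apply N).comp continuous_subtype_val
  have hd : DiscreteTopology Q := ⟨rfl⟩
  exact (isOpen_discrete {q : Q | QuotientGroup.kerLift (levelHom n) q = σ}).preimage hc

theorem measurableSet_trace_bdryTranslate (C : Compacts Ray) (n : ℕ) (S : Set (Fin n → Bool)) :
    MeasurableSet {γ : Completion | trace n (bdryTranslate γ C) = S} := by
  have : {γ : Completion | trace n (bdryTranslate γ C) = S} =
      ⋃ σ ∈ {σ : Equiv.Perm (Fin n → Bool) | σ • trace n C = S}, {γ | completionLevel n γ = σ} := by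
    ext γ
    simp [trace_bdryTranslate]
  rw [this]
  exact MeasurableSet.biUnion (Set.to_countable _) fun σ _ =>
    (isOpen_completionLevel_eq n σ).measurableSet

instance : IsProbabilityMeasure haar := by
  refine ⟨?_⟩
  have := Measure.haarMeasure_self (K₀ := (⊤ : PositiveCompacts Completion))
  exact this

instance : haar.IsMulLeftInvariant := inferInstanceAs (Measure.haarMeasure ⊤).IsMulLeftInvariant

theorem haar_trace_smul (C : Compacts Ray) (n : ℕ) (g : grigorchuk) (S : Set (Fin n → Bool)) :
    haar {γ | trace n (bdryTranslate γ C) = levelHom n g • S} =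
      haar {γ | trace n (bdryTranslate γ C) = S} := by
  rw [← measure_preimage_mul haar (eta g) {γ | trace n (bdryTranslate γ C) = levelHom n g • S}]
  congr 1
  ext γ
  simp only [Set.mem_preimage, Set.mem_ofPred_eq, trace_bdryTranslate, completionLevel_mul,
    completionLevel_eta, mul_smul]
  exact (MulAction.injective _).eq_iff

theorem fix_law_eq_haar {μ : Measure (Subgroup grigorchuk)} [IsProbabilityMeasure μ]
    [ErgodicSMul (ConjAct grigorchuk) (Subgroup grigorchuk) μ] {C : Compacts Ray}
    (hC : ∀ n, μ {H | trace n (fix H) ∈ MulAction.orbit (levelHom n).range (trace n C)} ≠ 0)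
    {B : Set (Compacts Ray)} (hB : MeasurableSet[borel (Compacts Ray)] B) :
    μ {H | fix H ∈ B} = haar {γ | bdryTranslate γ C ∈ B} := by
  have hm : Measurable fun γ => bdryTranslate γ C :=
    measurable_compacts (measurableSet_trace_bdryTranslate C)
  have key : μ.map fix = haar.map fun γ => bdryTranslate γ C := by
    have : IsProbabilityMeasure (μ.map fix) :=
      Measure.isProbabilityMeasure_map measurable_fix.aemeasurable
    have : IsProbabilityMeasure (haar.map fun γ => bdryTranslate γ C) :=
      Measure.isProbabilityMeasure_map hm.aemeasurable
    refine ext_of_generate_finite traceSets borel_eq_generateFrom_traceSets isPiSystem_traceSets ?_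
      (by rw [measure_univ, measure_univ])
    rintro _ ⟨⟨n, S⟩, rfl⟩
    rw [Measure.map_apply measurable_fix (measurableSet_traceSet n S),
      Measure.map_apply hm (measurableSet_traceSet n S)]
    have h1 := measure_eq_of_invariant (Γ := (levelHom n).range) (P := μ) (x₀ := trace n C)
      (f := fun H => trace n (fix H)) (measurableSet_trace_fix n) (by
        rintro ⟨_, g, rfl⟩ S
        rw [← SMulInvariantMeasure.measure_preimage_smul (ConjAct.toConjAct g)
          (measurableSet_trace_fix n _)]
        congr 1
        ext H
        simp only [Set.mem_preimage, Set.mem_ofPred_eq, trace_fix_conj]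
        exact (MulAction.injective (levelHom n g)).eq_iff) (by
        -- The event that the trace lies in the orbit of the trace of C is invariant and of positive
        -- measure, hence almost sure by ergodicity.
        refine ae_mem_of_invariant
          (s := {H | trace n (fix H) ∈ MulAction.orbit (levelHom n).range (trace n C)}) ?_ ?_ (hC n)
        · have : {H | trace n (fix H) ∈ MulAction.orbit (levelHom n).range (trace n C)} =
              ⋃ S ∈ MulAction.orbit (levelHom n).range (trace n C), {H | trace n (fix H) = S} := by
            ext H
            simp
          rw [this]
          exact MeasurableSet.biUnion (Set.to_countable _) fun S _ => measurableSet_trace_fix n S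
        · rintro g H ⟨σ, hσ⟩
          refine ⟨⟨levelHom n g, g, rfl⟩ * σ, ?_⟩
          rw [trace_fix_conj, ← hσ]
          exact mul_smul _ _ _) S
    have h2 := measure_eq_of_invariant (Γ := (levelHom n).range) (P := haar) (x₀ := trace n C)
      (f := fun γ => trace n (bdryTranslate γ C)) (measurableSet_trace_bdryTranslate C n) (by
        rintro ⟨_, g, rfl⟩ S
        exact haar_trace_smul C n g S)
      (Filter.Eventually.of_forall fun γ =>
        ⟨⟨_, completionLevel_mem_range n γ⟩, (trace_bdryTranslate n γ C).symm⟩) S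
    exact h1.trans h2.symm
  have := congrArg (fun m => m B) key
  rwa [Measure.map_apply measurable_fix hB, Measure.map_apply hm hB] at this

/-- Almost every closed set of fixed points is typical for its law on every level. -/
theorem ae_trace_orbit_ne_zero (μ : Measure (Subgroup grigorchuk)) :
    ∀ᵐ H₀ ∂μ, ∀ n,
      μ {H | trace n (fix H) ∈ MulAction.orbit (levelHom n).range (trace n (fix H₀))} ≠ 0 := by
  rw [ae_all_iff]
  intro n
  have h : ∀ᵐ H₀ ∂μ, ∀ S : Set (Fin n → Bool),
      μ {H | trace n (fix H) ∈ MulAction.orbit (levelHom n).range S} = 0 →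
        trace n (fix H₀) ∉ MulAction.orbit (levelHom n).range S := by
    rw [ae_all_iff]
    intro S
    by_cases h : μ {H | trace n (fix H) ∈ MulAction.orbit (levelHom n).range S} = 0
    · filter_upwards [measure_eq_zero_iff_ae_notMem.1 h] with H hH _
      exact hH
    · exact Filter.Eventually.of_forall fun _ h' => absurd h' h
  filter_upwards [h] with H hH h0
  exact hH _ h0 (MulAction.mem_orbit_self _)

/-! ### The sequence of levels -/

theorem smul_cylinder_vertex (g : grigorchuk) (n : ℕ) (x : Ray) :
    g • cylinder (vertex n x) = cylinder (vertex n (g • x)) := by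
  ext y
  rw [Set.mem_smul_set_iff_inv_smul_mem, mem_cylinder_vertex, mem_cylinder_vertex]
  constructor
  · intro h
    have := pre_smul g h
    rwa [smul_inv_smul] at this
  · intro h
    have := pre_smul g⁻¹ h
    rwa [inv_smul_smul] at this

theorem conj_mem_rist {m : ℕ} {v : List Bool} {x : Ray} (hx : x ∈ cylinder v) (g : grigorchuk)
    {k : grigorchuk} (hk : k ∈ rist m v) : g * k * g⁻¹ ∈ rist m (vertex v.length (g • x)) := by
  suffices h : rist m v ≤ (rist m (vertex v.length (g • x))).comap (MulAut.conj g).toMonoidHom from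
    h hk
  refine iSup₂_le fun w hw k hk => ?_
  show g * k * g⁻¹ ∈ rist m (vertex v.length (g • x))
  have h1 := smul_mem_rigidStab (g := g) hk
  obtain ⟨y, hy⟩ := cylinder_nonempty (v ++ w)
  set u := vertex (v ++ w).length (g • y)
  rw [cylinder_eq_of_mem hy, smul_cylinder_vertex] at h1
  have hyv := cylinder_append_subset _ _ hy
  have htake : u.take v.length = vertex v.length (g • x) := by
    have h2 := cylinder_eq_of_mem (mem_cylinder_take
      (self_mem_cylinder_vertex (v ++ w).length (g • y)) v.length)
    rw [List.length_take, length_vertex, min_eq_left (by simp)] at h2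
    rw [h2]
    rw [cylinder_eq_of_mem hx] at hyv
    exact congrArg List.ofFn (pre_smul g (mem_cylinder_vertex.1 hyv))
  have e : u = vertex v.length (g • x) ++ u.drop v.length := by
    rw [← htake, List.take_append_drop]
  change _ ∈ rigidStab (cylinder u) at h1
  rw [e] at h1
  exact rigidStab_le_rist (by simp [u, hw]) h1

theorem exists_level_ae (μ : Measure (Subgroup grigorchuk)) [IsProbabilityMeasure μ]
    [ErgodicSMul (ConjAct grigorchuk) (Subgroup grigorchuk) μ] (n : ℕ) :
    ∃ m, ∀ᵐ H ∂μ, ∀ v : List Bool, v.length = n → cylinder v ∩ fix H = ∅ →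
      ⁅rist m v, rist m v⁆ ≤ H := by
  let E : ℕ → Set (Subgroup grigorchuk) := fun m =>
    {H | ∀ v : List Bool, v.length = n → cylinder v ∩ fix H = ∅ → ⁅rist m v, rist m v⁆ ≤ H}
  have hE : ∀ m, MeasurableSet (E m) := by
    intro m
    have : E m = ⋂ v ∈ {v : List Bool | v.length = n},
        ({H | cylinder v ∩ fix H = ∅}ᶜ ∪ {H | ⁅rist m v, rist m v⁆ ≤ H}) := by
      ext H
      simp only [E, Set.mem_ofPred_eq, Set.mem_iInter, Set.mem_union, Set.mem_compl_iff,
        imp_iff_not_or]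
    rw [this]
    exact MeasurableSet.biInter (Set.to_countable _) fun v _ =>
      (measurableSet_disjoint_fix (isClosed_cylinder v)).compl.union (measurableSet_setOf_le _)
  -- Conjugation permutes the vertices of level n together with their groups Rist_m, so a depth that
  -- is uniform over the whole level is invariant.
  have hinv : ∀ m (g : grigorchuk), ∀ H ∈ E m, ConjAct.toConjAct g • H ∈ E m := by
    intro m g H hH v hv hvH
    obtain ⟨y, hy⟩ := cylinder_nonempty v
    have h1 := hH (vertex v.length (g⁻¹ • y)) (by simp [hv]) (by
      refine Set.subset_empty_iff.1 fun z hz => ?_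
      rw [← smul_cylinder_vertex, Set.mem_inter_iff, Set.mem_smul_set_iff_inv_smul_mem, inv_inv,
        ← cylinder_eq_of_mem hy] at hz
      have h2 : g • z ∈ cylinder v ∩ fix (ConjAct.toConjAct g • H) := by
        refine ⟨hz.1, ?_⟩
        rw [fix_conj]
        exact ⟨z, hz.2, rfl⟩
      rw [hvH] at h2
      exact h2)
    rw [Subgroup.commutator_le] at h1 ⊢
    intro p hp q hq
    have h2 := h1 _ (conj_mem_rist hy g⁻¹ hp) _ (conj_mem_rist hy g⁻¹ hq)
    rw [mem_conj_smul]
    convert h2 using 1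
    simp only [commutatorElement_def]
    group
  -- The events cover almost everything, taking the largest depth over the finitely many vertices of
  -- level n; one of them has positive measure and is then almost sure.
  obtain ⟨m, hm⟩ : ∃ m, μ (E m) ≠ 0 := by
    by_contra! h0
    have hU : μ (⋃ m, E m) = 0 := measure_iUnion_null h0
    have h1 : ∀ᵐ H ∂μ, H ∈ ⋃ m, E m := by
      filter_upwards [ae_commutatorBelow μ] with H hH
      have hH' : ∀ v : List Bool, ∃ m, cylinder v ∩ fix H = ∅ → ⁅rist m v, rist m v⁆ ≤ H := by
        intro v
        by_cases hv : cylinder v ∩ fix H = ∅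
        · obtain ⟨m, hm⟩ := hH v hv
          exact ⟨m, fun _ => hm⟩
        · exact ⟨0, fun h => absurd h hv⟩
      choose f hf using hH'
      have hfin : {v : List Bool | v.length = n}.Finite := List.finite_length_eq Bool n
      refine Set.mem_iUnion.2 ⟨hfin.toFinset.sup f, fun v hv hvH => le_trans ?_ (hf v hvH)⟩
      have : f v ≤ hfin.toFinset.sup f := Finset.le_sup (hfin.mem_toFinset.2 hv)
      exact Subgroup.commutator_mono (rist_anti this _) (rist_anti this _)
    have h2 := measure_eq_zero_iff_ae_notMem.1 hU
    obtain ⟨H, h, h'⟩ := (h1.and h2).exists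
    exact h' h
  exact ⟨m, ae_mem_of_invariant (hE m) (hinv m) hm⟩

theorem exists_derivedSum_le_ae (μ : Measure (Subgroup grigorchuk)) [IsProbabilityMeasure μ]
    [ErgodicSMul (ConjAct grigorchuk) (Subgroup grigorchuk) μ] :
    ∃ m : ℕ → ℕ, ∀ᵐ H ∂μ, derivedSum m (fix H) ≤ H := by
  choose m hm using exists_level_ae μ
  refine ⟨m, ?_⟩
  filter_upwards [ae_all_iff.2 hm] with H hH
  exact iSup₂_le fun v hv => hH v.length v rfl hv.1

/-! ### Atoms -/

instance : MeasurableSingletonClass (Subgroup grigorchuk) where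
  measurableSet_singleton Γ := by
    have : {Γ} = ⋂ g : grigorchuk, {H : Subgroup grigorchuk | g ∈ H ↔ g ∈ Γ} := by
      ext H
      simp [SetLike.ext_iff]
    rw [this]
    refine MeasurableSet.iInter fun g => ?_
    by_cases hg : g ∈ Γ
    · simpa only [hg, iff_true] using measurableSet_setOf_mem g
    · have e : {H : Subgroup grigorchuk | g ∈ H ↔ g ∈ Γ} = {H | g ∈ H}ᶜ := by
        ext H
        simp [hg]
      rw [e]
      exact (measurableSet_setOf_mem g).compl

theorem measure_singleton_of_mem_orbit {μ : Measure (Subgroup grigorchuk)}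
    [SMulInvariantMeasure (ConjAct grigorchuk) (Subgroup grigorchuk) μ] {Γ H : Subgroup grigorchuk}
    (hH : H ∈ MulAction.orbit (ConjAct grigorchuk) Γ) : μ {H} = μ {Γ} := by
  obtain ⟨g, rfl⟩ := hH
  rw [← SMulInvariantMeasure.measure_preimage_smul g (measurableSet_singleton (g • Γ))]
  congr 1
  ext K
  exact (MulAction.injective g).eq_iff

/-- All conjugates of an atom have the same positive mass, and the total mass is finite. -/
theorem finite_orbit_of_atom {μ : Measure (Subgroup grigorchuk)} [IsProbabilityMeasure μ]
    [SMulInvariantMeasure (ConjAct grigorchuk) (Subgroup grigorchuk) μ] {Γ : Subgroup grigorchuk}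
    (hΓ : μ {Γ} ≠ 0) : (MulAction.orbit (ConjAct grigorchuk) Γ).Finite := by
  refine (Measure.finite_const_le_meas_of_disjoint_iUnion μ (pos_iff_ne_zero.2 hΓ)
    (As := fun H : Subgroup grigorchuk => {H}) (fun H => measurableSet_singleton H)
    (fun H K h => Set.disjoint_singleton.2 h) (measure_ne_top _ _)).subset fun H hH => ?_
  exact (measure_singleton_of_mem_orbit hH).ge

theorem ae_mem_orbit_of_atom {μ : Measure (Subgroup grigorchuk)} [IsProbabilityMeasure μ]
    [ErgodicSMul (ConjAct grigorchuk) (Subgroup grigorchuk) μ] {Γ : Subgroup grigorchuk}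
    (hΓ : μ {Γ} ≠ 0) : ∀ᵐ H ∂μ, H ∈ MulAction.orbit (ConjAct grigorchuk) Γ := by
  refine ae_mem_of_invariant (finite_orbit_of_atom hΓ).measurableSet ?_ fun h => hΓ ?_
  · intro g H hH
    exact MulAction.mem_orbit_of_mem_orbit _ hH
  · exact measure_mono_null (Set.singleton_subset_iff.2 (MulAction.mem_orbit_self Γ)) h

theorem eq_uniformOn_of_atom {μ : Measure (Subgroup grigorchuk)} [IsProbabilityMeasure μ]
    [ErgodicSMul (ConjAct grigorchuk) (Subgroup grigorchuk) μ] {Γ : Subgroup grigorchuk}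
    (hΓ : μ {Γ} ≠ 0) : μ = uniformOn (MulAction.orbit (ConjAct grigorchuk) Γ) := by
  have hfin := finite_orbit_of_atom hΓ
  have hae := ae_mem_orbit_of_atom hΓ
  set O := MulAction.orbit (ConjAct grigorchuk) Γ with hO
  have key : ∀ s ⊆ O, μ s = Measure.count s * μ {Γ} := by
    intro s hs
    obtain ⟨F, rfl⟩ := (hfin.subset hs).exists_finset_coe
    rw [← sum_measure_singleton, Measure.count_apply_finset,
      Finset.sum_congr rfl fun x hx => measure_singleton_of_mem_orbit (hs hx), Finset.sum_const,
      nsmul_eq_mul]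
  have hμO : μ O = 1 := by
    rw [← measure_univ (μ := μ)]
    exact measure_congr (Filter.eventuallyEq_univ.2 hae)
  have hc : μ {Γ} = (Measure.count O)⁻¹ := by
    rw [key O subset_rfl, mul_comm] at hμO
    exact ENNReal.eq_inv_of_mul_eq_one_left hμO
  ext s hs
  rw [uniformOn, cond_apply hfin.measurableSet, ← hc, mul_comm, ← key _ Set.inter_subset_left]
  refine measure_congr ?_
  filter_upwards [hae] with H hH
  exact propext ⟨fun h => ⟨hH, h⟩, fun h => h.2⟩

theorem measurableSet_fix_eq {C : Set Ray} (hC : IsClosed C) :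
    MeasurableSet {H : Subgroup grigorchuk | (fix H : Set Ray) = C} := by
  have : {H : Subgroup grigorchuk | (fix H : Set Ray) = C} =
      ⋂ n, {H : Subgroup grigorchuk | trace n (fix H) = trace n C} := by
    ext H
    simp only [Set.mem_ofPred_eq, Set.mem_iInter]
    exact ⟨fun h n => by rw [h], fun h => eq_of_forall_trace_eq (fix H).isCompact.isClosed hC h⟩
  rw [this]
  exact MeasurableSet.iInter fun n => measurableSet_trace_fix n _

theorem le_fixingSubgroup_fix (H : Subgroup grigorchuk) :
    H ≤ fixingSubgroup grigorchuk (fix H : Set Ray) := fun g hg =>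
  (mem_fixingSubgroup_iff grigorchuk).2 fun _ hx => mem_fix.1 hx g hg

/-- There are finitely many subgroups of a subgroup `Φ` that contain a given congruence subgroup
of `Φ`. -/
theorem finite_setOf_levelStab_inf_le (M : ℕ) (Φ : Subgroup grigorchuk) :
    {H : Subgroup grigorchuk | levelStab M ⊓ Φ ≤ H ∧ H ≤ Φ}.Finite := by
  refine Set.Finite.of_finite_image (f := fun H => H.map (QuotientGroup.mk' (levelStab M)))
    (Set.toFinite _) ?_
  have key : ∀ {H K : Subgroup grigorchuk}, H ≤ Φ → levelStab M ⊓ Φ ≤ K → K ≤ Φ →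
      H.map (QuotientGroup.mk' (levelStab M)) = K.map (QuotientGroup.mk' (levelStab M)) →
      H ≤ K := by
    intro H K hH hK hK' e h hh
    have h1 : QuotientGroup.mk' (levelStab M) h ∈ K.map (QuotientGroup.mk' (levelStab M)) :=
      e ▸ Subgroup.mem_map_of_mem _ hh
    obtain ⟨k, hk, e'⟩ := h1
    have h2 : k⁻¹ * h ∈ levelStab M := QuotientGroup.eq.1 e'
    have h3 := hK (Subgroup.mem_inf.2 ⟨h2, mul_mem (inv_mem (hK' hk)) (hH hh)⟩)
    simpa using mul_mem hk h3
  intro H hH K hK e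
  exact (key hH.2 hK.1 hK.2 e).antisymm (key hK.2 hH.1 hH.2 e.symm)

end FirstGrigorchuk

open FirstGrigorchuk

-- The three types

theorem mainTheorem7 (μ : Measure (Subgroup grigorchuk)) [IsProbabilityMeasure μ]
    [ErgodicSMul (ConjAct grigorchuk) (Subgroup grigorchuk) μ] :
    ((∀ᵐ H ∂μ, (fix H : Set Ray) = ∅) ∧
      (∀ᵐ H ∂μ, H.FiniteIndex) ∧
      ∃ m : ℕ, ∀ᵐ H ∂μ, levelStab m ≤ H) ∨
    ((∀ᵐ H ∂μ, (fix H : Set Ray).Nonempty ∧ IsClopen (fix H : Set Ray)) ∧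
      (∃ S : Set (Subgroup grigorchuk), S.Countable ∧ μ Sᶜ = 0) ∧
      ∃ (C : Set Ray) (Γ : Subgroup grigorchuk),
        C.Nonempty ∧ IsClopen C ∧
        Γ ≤ fixingSubgroup grigorchuk C ∧ Γ.IsFiniteRelIndex (fixingSubgroup grigorchuk C) ∧
        (MulAction.orbit (ConjAct grigorchuk) Γ).Finite ∧
        μ = uniformOn (MulAction.orbit (ConjAct grigorchuk) Γ)) ∨
    ((∀ᵐ H ∂μ, ¬ IsClopen (fix H : Set Ray)) ∧
      (∀ H : Subgroup grigorchuk, μ {H} = 0) ∧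
      ∃ (C : Compacts Ray) (m : ℕ → ℕ),
        ¬ IsClopen (C : Set Ray) ∧
        (∀ B : Set (Compacts Ray), MeasurableSet[borel (Compacts Ray)] B →
          μ {H | fix H ∈ B} = haar {γ | bdryTranslate γ C ∈ B}) ∧
        ∀ᵐ H ∂μ, derivedSum m (fix H) ≤ H) := by
  obtain ⟨m, hm⟩ := exists_derivedSum_le_ae μ
  -- Positive mass on one clopen value is the dividing line: types (i) and (ii) according to whether
  -- C is empty, type (iii) if there is no such C.
  by_cases hcl : ∃ C : Set Ray, IsClopen C ∧ μ {H | (fix H : Set Ray) = C} ≠ 0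
  · obtain ⟨C, hC, hμC⟩ := hcl
    obtain ⟨M, hM⟩ := exists_levelStab_inf_le_derivedSum hC m
    rcases C.eq_empty_or_nonempty with rfl | hne
    · left
      have hfix : ∀ᵐ H ∂μ, (fix H : Set Ray) = ∅ := by
        refine ae_mem_of_invariant (measurableSet_fix_eq isClosed_empty) ?_ hμC
        intro g H hH
        show (fix (ConjAct.toConjAct g • H) : Set Ray) = ∅
        rw [fix_conj, show (fix H : Set Ray) = ∅ from hH, Set.image_empty]
      have hle : ∀ᵐ H ∂μ, levelStab M ≤ H := by
        filter_upwards [hfix, hm] with H h1 h2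
        rw [h1] at h2
        refine le_trans (fun g hg => hM ⟨hg, ?_⟩) h2
        exact (mem_fixingSubgroup_iff grigorchuk).2 fun _ hx => absurd hx (Set.notMem_empty _)
      refine ⟨hfix, ?_, M, hle⟩
      filter_upwards [hle] with H hH
      exact Subgroup.finiteIndex_of_le hH
    · right; left
      -- T is a finite set of positive measure, so one of its members is an atom.
      let T : Set (Subgroup grigorchuk) := {H | (fix H : Set Ray) = C ∧ derivedSum m C ≤ H}
      have hT : T.Finite := by
        refine (finite_setOf_levelStab_inf_le M (fixingSubgroup grigorchuk C)).subset ?_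
        rintro H ⟨rfl, h2⟩
        exact ⟨hM.trans h2, le_fixingSubgroup_fix H⟩
      have hμT : μ T ≠ 0 := by
        have : μ T = μ {H | (fix H : Set Ray) = C} := by
          refine measure_congr ?_
          filter_upwards [hm] with H hH
          refine propext ⟨fun h => h.1, fun h => ⟨h, ?_⟩⟩
          have h' : (fix H : Set Ray) = C := h
          rwa [h'] at hH
        rwa [this]
      obtain ⟨Γ, hΓT, hΓ⟩ : ∃ Γ ∈ T, μ {Γ} ≠ 0 := by
        by_contra! h
        refine hμT ?_
        rw [← Set.biUnion_of_singleton T]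
        exact (measure_biUnion_null_iff hT.countable).2 h
      have hae := ae_mem_orbit_of_atom hΓ
      obtain ⟨hΓC, hΓm⟩ := hΓT
      refine ⟨?_, ⟨_, (finite_orbit_of_atom hΓ).countable, ?_⟩, C, Γ, hne, hC, ?_, ⟨?_⟩,
        finite_orbit_of_atom hΓ, eq_uniformOn_of_atom hΓ⟩
      · filter_upwards [hae] with H hH
        obtain ⟨g, rfl⟩ := hH
        have : (fix (g • Γ) : Set Ray) = smulHomeo (ConjAct.ofConjAct g) '' C := by
          rw [← hΓC]
          exact fix_conj (ConjAct.ofConjAct g) Γ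
        rw [this]
        exact ⟨hne.image _, (smulHomeo _).isClosedMap _ hC.isClosed,
          (smulHomeo _).isOpenMap _ hC.isOpen⟩
      · exact hae
      · rw [← hΓC]
        exact le_fixingSubgroup_fix Γ
      · intro h0
        -- An infinite index is recorded as 0 and would propagate through divisibility to the index
        -- of St(M), which is finite.
        have h1 := Subgroup.relIndex_dvd_of_le_left (fixingSubgroup grigorchuk C) (hM.trans hΓm)
        rw [h0, Subgroup.inf_relIndex_right, zero_dvd_iff] at h1
        have h2 := Subgroup.relIndex_dvd_index_of_normal (levelStab M)
          (fixingSubgroup grigorchuk C)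
        rw [h1, zero_dvd_iff] at h2
        exact Subgroup.FiniteIndex.index_ne_zero h2
  · right; right
    push Not at hcl
    have hnc : ∀ᵐ H ∂μ, ¬ IsClopen (fix H : Set Ray) := by
      have h : ∀ᵐ H ∂μ, ∀ p : Σ n : ℕ, Set (Fin n → Bool), (fix H : Set Ray) ≠ pre p.1 ⁻¹' p.2 :=
        ae_all_iff.2 fun p =>
          measure_eq_zero_iff_ae_notMem.1 (hcl _ (isClopen_pre_preimage p.1 p.2))
      filter_upwards [h] with H hH hclopen
      obtain ⟨n, S, e⟩ := isClopen_iff_exists_trace.1 hclopen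
      exact hH ⟨n, S⟩ e
    refine ⟨hnc, fun Γ => ?_, ?_⟩
    · by_contra hΓ
      have h1 : ¬ IsClopen (fix Γ : Set Ray) := by
        intro h
        refine hΓ (measure_mono_null ?_ hnc)
        rintro _ rfl
        exact fun h' => h' h
      refine h1 (isClopen_of_finite_translates (fix Γ).isCompact.isClosed ?_)
      refine ((finite_orbit_of_atom hΓ).image fun H => (fix H : Set Ray)).subset ?_
      rintro _ ⟨g, rfl⟩
      exact ⟨ConjAct.toConjAct g • Γ, ⟨_, rfl⟩, fix_conj g Γ⟩
    -- The set C is Fix(H₀) for a typical H₀: not clopen, and with a trace orbit of positive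
    -- probability on every level.
    · obtain ⟨H₀, h1, h2⟩ := (hnc.and (ae_trace_orbit_ne_zero μ)).exists
      exact ⟨fix H₀, m, h1, fun B hB => fix_law_eq_haar h2 hB, hm⟩
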